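/- **Setting.** Fix a set $\mathsf{Tid}$ of thread identifiers and a set $\mathsf{Id}$ of action identifiers. The register object has methods $\mathtt{read},\mathtt{write}$ and values $\mathbb N$. Its actions are invocations $\mathtt{inv}\langle m,v,p,k\rangle$ and responses $\mathtt{res}\langle m,v,p,k\rangle$ with $m$ a method, $v\in\mathbb N\cup\{\bot\}$, $p\in\mathsf{Tid}$, $k\in\mathsf{Id}$. A history is a finite sequence of actions. It is *sequential* if it alternates between invocations and responses, starting with an invocation, each response has the method, thread and action identifier of the invocation just before it, and distinct operations have distinct pairs (thread identifier, action identifier). It is *well-formed* if its restriction to each thread is sequential. An invocation is *pending* if no response in the history has its thread and action identifiers; $\mathsf{completed}(h)$ is the subsequence of actions of completed operations. The operations of $h$ are its pending invocations and its matching invocation–response pairs, and $o_1<_h o_2$ means that the response of $o_1$ occurs in $h$ before the invocation of $o_2$. The *register specification* $\mathsf{Spec}$ is the set of sequential histories in which reads are invoked with $\bot$, writes are invoked with a natural number and return $\bot$, and each read returns the input of the last preceding write, or $0$ if there is none. For a well-formed $h$ and a sequential $s$, write $h\sqsubseteq s$ if there is a sequence $r$ of responses such that $h\cdot r$ is well-formed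 and, with $h'=\mathsf{completed}(h\cdot r)$, the histories $h'$ and $s$ have the same set of operations and $<_{h'}\subseteq <_s$. A *register implementation* $I$ is a labeled transition system with an initial state whose labels are register actions or internal labels, such that each finite execution $e$ (a sequence of consecutive transitions from the initial state) induces a well-formed history $h(e)$ (the register actions among its labels), in which reads are invoked with $\bot$ and writes with a natural number. It is *decisively linearizable* if there is a map $L$ from its executions to $\mathsf{Spec}$ such that $h(e)\sqsubseteq L(e)$ for every execution $e$, and $L(e_1)$ is a (not necessarily contiguous) subsequence of $L(e_2)$ whenever $e_1$ is a prefix of $e_2$. A *forward simulation* from $I$ to $I'$ is a relation $R$ between their states that relates the initial states and such that, whenever $q\xrightarrow{\sigma}q'$ in $I$ and $(q,b)\in R$, there are $b'$ and a finite, possibly empty, sequence of transitions of $I'$ from $b$ to $b'$ with $(q',b')\in R$, whose sequence of non-internal labels is that of $\sigma$ (empty if $\sigma$ is internal). **The implementation $\mathtt{DR}$.** A state consists of a value $X\in\mathbb N$, a version $\mathit{Ver}\in\mathbb N$ and a lock $\ell\in\{0,1\}$ (all initially $0$), and for each thread $p$: the sequence $\mathit{ID}(p)$ of used action identifiers (initially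 empty), a location $\mathit{PC}(p)\in\{\mathtt{main},\mathtt{w_b},\mathtt{w_w},\mathtt{w_r},\mathtt{w_e},\mathtt{r_b},\mathtt{r_l},\mathtt{r_e}\}$ (initially $\mathtt{main}$), a set $\mathit{VS}(p)\subseteq\mathbb N$ (initially empty), and $S(p),A(p)\in\mathbb N$ (initially $0$). Its transitions, for each thread $p$, are the following; components that are not mentioned keep their values. * *read-inv*, label $\mathtt{inv}\langle\mathtt{read},\bot,p,k\rangle$: if $\mathit{PC}(p)=\mathtt{main}$ and $k\notin \mathit{ID}(p)$, append $k$ to $\mathit{ID}(p)$ and set $\mathit{PC}(p):=\mathtt{r_b}$. * *read-init*, internal: if $\mathit{PC}(p)=\mathtt{r_b}$ and $\ell=0$, set $\mathit{VS}(p):=\{X\}$, $S(p):=\mathit{Ver}$, $\mathit{PC}(p):=\mathtt{r_l}$. * *read-loop*, internal: if $\mathit{PC}(p)=\mathtt{r_l}$, $X\notin \mathit{VS}(p)$ and $\mathit{Ver}\ge S(p)$, add $X$ to $\mathit{VS}(p)$. * *read-pick*, internal: if $\mathit{PC}(p)=\mathtt{r_l}$ and $v\in \mathit{VS}(p)$,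 set $A(p):=v$, $\mathit{PC}(p):=\mathtt{r_e}$. * *read-res*, label $\mathtt{res}\langle\mathtt{read},A(p),p,k\rangle$ with $k$ the last element of $\mathit{ID}(p)$: if $\mathit{PC}(p)=\mathtt{r_e}$, set $\mathit{PC}(p):=\mathtt{main}$, $\mathit{VS}(p):=\emptyset$, $S(p):=0$, $A(p):=0$. * *write-inv*, label $\mathtt{inv}\langle\mathtt{write},v,p,k\rangle$ with $v\in\mathbb N$: if $\mathit{PC}(p)=\mathtt{main}$ and $k\notin \mathit{ID}(p)$, append $k$ to $\mathit{ID}(p)$ and set $A(p):=v$, $\mathit{PC}(p):=\mathtt{w_b}$. * *write-init*, internal: if $\mathit{PC}(p)=\mathtt{w_b}$ and $\ell=0$, set $S(p):=\mathit{Ver}$, $\mathit{PC}(p):=\mathtt{w_w}$. * *write-top*, internal: if $\mathit{PC}(p)=\mathtt{w_w}$ and $\ell=0$, set $X:=A(p)$, $\mathit{Ver}:=\mathit{Ver}+1$, $\mathit{PC}(p):=\mathtt{w_e}$. * *write-roll-back*, internal: if $\mathit{PC}(p)=\mathtt{w_w}$, $\ell=0$ and $\mathit{Ver}>S(p)$,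 simultaneously set $X:=A(p)$, $A(p):=X$, $\mathit{Ver}:=\mathit{Ver}-1$, $\ell:=1$, $\mathit{PC}(p):=\mathtt{w_r}$. * *write-roll-forward*, internal: if $\mathit{PC}(p)=\mathtt{w_r}$ and $\ell=1$, set $X:=A(p)$, $\mathit{Ver}:=\mathit{Ver}+1$, $\ell:=0$, $\mathit{PC}(p):=\mathtt{w_e}$. * *write-res*, label $\mathtt{res}\langle\mathtt{write},\bot,p,k\rangle$ with $k$ the last element of $\mathit{ID}(p)$: if $\mathit{PC}(p)=\mathtt{w_e}$, set $\mathit{PC}(p):=\mathtt{main}$, $\mathit{VS}(p):=\emptyset$, $S(p):=0$, $A(p):=0$. **Theorem.** $\mathtt{DR}$ is complete for the class of decisively linearizable register implementations: $\mathtt{DR}$ is a register implementation and is decisively linearizable, and for every decisively linearizable register implementation $I$ there is a forward simulation from $I$ to $\mathtt{DR}$. -/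

import Mathlib

namespace RegSim

universe u v w x y z

/-! ### Labeled transition systems -/

/-- A labeled transition system with state set `Q` and alphabet `Lab`. -/
structure LTS (Q : Type u) (Lab : Type v) where
  init : Q
  step : Q → Lab → Q → Prop

namespace LTS

variable {Q : Type u} {Lab : Type v}

/-- `A.IsPath q e`: the sequence `e` of triples (source, label, target) consists of transitions
of `A`, the first one starts in `q`, and each other one starts in the target of the previous one. -/
def IsPath (A : LTS Q Lab) : Q → List (Q × Lab × Q) → Prop
  | _, [] => True
  | q, t :: e => t.1 = q ∧ A.step t.1 t.2.1 t.2.2 ∧ A.IsPath t.2.2 e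

/-- The (finite, possibly empty) executions of `A`. -/
def Exec (A : LTS Q Lab) : Type (max u v) :=
  {e : List (Q × Lab × Q) // A.IsPath A.init e}

/-- The trace of labels of an execution. -/
def Exec.trace {A : LTS Q Lab} (e : A.Exec) : List Lab :=
  e.1.map (fun t => t.2.1)

/-- `A.Steps q ρ q'`: there are consecutive transitions of `A` from `q` to `q'` labeled by `ρ`. -/
def Steps (A : LTS Q Lab) : Q → List Lab → Q → Prop
  | q, [], q' => q = q'
  | q, l :: ρ, q' => ∃ q₁, A.step q l q₁ ∧ A.Steps q₁ ρ q'

end LTS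

/-! ### Actions and histories of an object with methods `M` and values `Val` -/

/-- Invocations and responses; a value in `Val ∪ {⊥}` is an `Option Val`, where `none` is `⊥`. -/
inductive Action (M : Type u) (Val : Type v) (Tid : Type w) (Id : Type x) where
  | inv (m : M) (v : Option Val) (p : Tid) (k : Id)
  | res (m : M) (v : Option Val) (p : Tid) (k : Id)

namespace Action

variable {M : Type u} {Val : Type v} {Tid : Type w} {Id : Type x}

def isInv : Action M Val Tid Id → Bool
  | inv _ _ _ _ => true
  | res _ _ _ _ => false

def isRes : Action M Val Tid Id → Bool
  | inv _ _ _ _ => false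
  | res _ _ _ _ => true

def method : Action M Val Tid Id → M
  | inv m _ _ _ => m
  | res m _ _ _ => m

def tid : Action M Val Tid Id → Tid
  | inv _ _ p _ => p
  | res _ _ p _ => p

def id : Action M Val Tid Id → Id
  | inv _ _ _ k => k
  | res _ _ _ k => k

/-- The thread identifier together with the action identifier. -/
def key (a : Action M Val Tid Id) : Tid × Id := (a.tid, a.id)

/-- An invocation and a response with the same method, thread and action identifiers. -/
def Matches (i r : Action M Val Tid Id) : Prop :=
  i.isInv ∧ r.isRes ∧ i.method = r.method ∧ i.tid = r.tid ∧ i.id = r.id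

end Action

section Histories

variable {M : Type u} {Val : Type v} {Tid : Type w} {Id : Type x}

/-- The sequence alternates between invocations and responses, starting with an invocation
(and possibly ending with one), each response matching the invocation just before it. -/
inductive Alternating : List (Action M Val Tid Id) → Prop
  | nil : Alternating []
  | single (i : Action M Val Tid Id) (hi : i.isInv) : Alternating [i]
  | cons (i r : Action M Val Tid Id) (h : List (Action M Val Tid Id))
      (hir : i.Matches r) (hh : Alternating h) : Alternating (i :: r :: h)

/-- Sequential histories.  Operations are identified by the pair of their thread and action
identifiers; no two operations of the history share that pair. -/
def Sequential (h : List (Action M Val Tid Id)) : Prop :=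
  Alternating h ∧ ((h.filter Action.isInv).map Action.key).Nodup

open scoped Classical in
/-- The restriction `h|p` of a history to the actions of a thread. -/
noncomputable def proj (p : Tid) (h : List (Action M Val Tid Id)) : List (Action M Val Tid Id) :=
  h.filter (fun a => a.tid = p)

def WellFormed (h : List (Action M Val Tid Id)) : Prop :=
  ∀ p : Tid, Sequential (proj p h)

/-- Some response in `h` has the same thread and action identifiers as `a`. -/
def HasResponse (h : List (Action M Val Tid Id)) (a : Action M Val Tid Id) : Prop :=
  ∃ r ∈ h, r.isRes ∧ r.key = a.key

open scoped Classical in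
/-- The subsequence of actions that are part of completed operations. -/
noncomputable def completed (h : List (Action M Val Tid Id)) : List (Action M Val Tid Id) :=
  h.filter (fun a => HasResponse h a)

end Histories

/-- An operation is an invocation (`res = none`), or a pair of an invocation and a response. -/
structure Operation (M : Type u) (Val : Type v) (Tid : Type w) (Id : Type x) where
  inv : Action M Val Tid Id
  res : Option (Action M Val Tid Id)

section Linearizations

variable {M : Type u} {Val : Type v} {Tid : Type w} {Id : Type x}

/-- The set of operations of a history: pending invocations, and matching pairs. -/
def operations (h : List (Action M Val Tid Id)) : Set (Operation M Val Tid Id) :=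
  {o | o.inv ∈ h ∧ o.inv.isInv ∧
    ((o.res = none ∧ ¬ HasResponse h o.inv) ∨ ∃ r ∈ h, o.res = some r ∧ o.inv.Matches r)}

/-- The real-time order: the response of `o₁` appears in `h` before the invocation of `o₂`. -/
def RealTime (h : List (Action M Val Tid Id)) (o₁ o₂ : Operation M Val Tid Id) : Prop :=
  ∃ r, o₁.res = some r ∧ [r, o₂.inv].Sublist h

/-- `s` is a linearization of `h` (written `h ⊑ s`): one can append responses of pending
operations to `h` so that the completed part `h'` of the result has the same operations as the
sequential history `s`, and `s` respects the real-time order of `h'`. -/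
def LinearizedBy (h s : List (Action M Val Tid Id)) : Prop :=
  Sequential s ∧
  ∃ rs : List (Action M Val Tid Id), (∀ r ∈ rs, r.isRes) ∧ WellFormed (h ++ rs) ∧
    operations (completed (h ++ rs)) = operations s ∧
    ∀ o₁ ∈ operations (completed (h ++ rs)), ∀ o₂ ∈ operations (completed (h ++ rs)),
      RealTime (completed (h ++ rs)) o₁ o₂ → RealTime s o₁ o₂

theorem Alternating.of_prefix {s : List (Action M Val Tid Id)} (hs : Alternating s) :
    ∀ {t : List (Action M Val Tid Id)}, t.IsPrefix s → Alternating t := by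
  induction hs with
  | nil =>
    intro t ht
    rw [List.prefix_nil.1 ht]
    exact .nil
  | single i hi =>
    intro t ht
    cases t with
    | nil => exact .nil
    | cons a t =>
      obtain ⟨rfl, ht₁⟩ := List.cons_prefix_cons.1 ht
      rw [List.prefix_nil.1 ht₁]
      exact .single a hi
  | cons i r h hir hh ih =>
    intro t ht
    cases t with
    | nil => exact .nil
    | cons a t =>
      obtain ⟨rfl, ht₁⟩ := List.cons_prefix_cons.1 ht
      clear ht
      cases t with
      | nil => exact .single a hir.1
      | cons b t =>
        obtain ⟨rfl, ht₂⟩ := List.cons_prefix_cons.1 ht₁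
        exact .cons a b t hir (ih ht₂)

theorem Sequential.of_prefix {s t : List (Action M Val Tid Id)} (hs : Sequential s)
    (ht : t.IsPrefix s) : Sequential t :=
  ⟨hs.1.of_prefix ht, hs.2.sublist ((ht.sublist.filter _).map _)⟩

end Linearizations

/-- A specification: a prefix-closed set of sequential histories. -/
structure Specification (M : Type u) (Val : Type v) (Tid : Type w) (Id : Type x) where
  carrier : Set (List (Action M Val Tid Id))
  sequential : ∀ s ∈ carrier, Sequential s
  prefix_closed : ∀ s ∈ carrier, ∀ t : List (Action M Val Tid Id), t.IsPrefix s → t ∈ carrier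

/-! ### Implementations, decisive linearizability, forward simulation

An implementation is an LTS over the disjoint union of the actions of the object and a set of
internal labels. -/

section Implementations

variable {M : Type u} {Val : Type v} {Tid : Type w} {Id : Type x} {ι : Type y} {Q : Type z}

/-- The history induced by an execution. -/
def hist {A : LTS Q (Action M Val Tid Id ⊕ ι)} (e : A.Exec) : List (Action M Val Tid Id) :=
  e.trace.filterMap Sum.getLeft?

/-- All executions of an implementation induce well-formed histories. -/
def IsImplementation (A : LTS Q (Action M Val Tid Id ⊕ ι)) : Prop :=
  ∀ e : A.Exec, WellFormed (hist e)

/-- `L` maps each execution to a linearization, in the specification, of its history. -/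
def IsLinearizationMapping (A : LTS Q (Action M Val Tid Id ⊕ ι))
    (S : Specification M Val Tid Id) (L : A.Exec → List (Action M Val Tid Id)) : Prop :=
  ∀ e : A.Exec, L e ∈ S.carrier ∧ LinearizedBy (hist e) (L e)

/-- `L e₁` is a subsequence of `L e₂` whenever `e₁` is a prefix of `e₂`. -/
def IsDecisive {A : LTS Q (Action M Val Tid Id ⊕ ι)}
    (L : A.Exec → List (Action M Val Tid Id)) : Prop :=
  ∀ e₁ e₂ : A.Exec, e₁.1.IsPrefix e₂.1 → (L e₁).Sublist (L e₂)

def DecisivelyLinearizable (A : LTS Q (Action M Val Tid Id ⊕ ι))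
    (S : Specification M Val Tid Id) : Prop :=
  ∃ L : A.Exec → List (Action M Val Tid Id), IsLinearizationMapping A S L ∧ IsDecisive L

/-- `R` is a forward simulation from `A` to `B` with respect to the set of all invocations and
responses: `Sum.getLeft?` keeps these labels and erases internal ones. -/
def IsForwardSimulation {κ : Type*} {Q' : Type*} (A : LTS Q (Action M Val Tid Id ⊕ ι))
    (B : LTS Q' (Action M Val Tid Id ⊕ κ)) (R : Q → Q' → Prop) : Prop :=
  R A.init B.init ∧
  ∀ q σ q' b, A.step q σ q' → R q b →
    ∃ (b' : Q') (ρ : List (Action M Val Tid Id ⊕ κ)),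
      B.Steps b ρ b' ∧ ρ.filterMap Sum.getLeft? = [σ].filterMap Sum.getLeft? ∧ R q' b'

/-- `A ≲ B`: there is a forward simulation from `A` to `B`. -/
def Simulates {κ : Type*} {Q' : Type*} (A : LTS Q (Action M Val Tid Id ⊕ ι))
    (B : LTS Q' (Action M Val Tid Id ⊕ κ)) : Prop :=
  ∃ R : Q → Q' → Prop, IsForwardSimulation A B R

end Implementations

/-! ### Registers -/

inductive RegMethod where
  | read
  | write

/-- The actions of the register object, whose values are the natural numbers. -/
abbrev RegAction (Tid : Type w) (Id : Type x) := Action RegMethod ℕ Tid Id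

section Registers

variable {Tid : Type w} {Id : Type x}

/-- The input of the last write in the sequence, or the initial value `0` if there is none. -/
def regValue (s : List (RegAction Tid Id)) : ℕ :=
  s.foldl (fun x a => match a with
    | .inv .write (some v) _ _ => v
    | _ => x) 0

/-- Reads are invoked without argument, and writes are invoked with a value. -/
def ProperInvocation : RegAction Tid Id → Prop
  | .inv .read v _ _ => v = none
  | .inv .write v _ _ => ∃ n, v = some n
  | .res _ _ _ _ => True

/-- The action `a` is allowed by the register right after `s`: invocations are proper,
writes return `⊥`, and reads return the current value. -/
def RegAllowed (s : List (RegAction Tid Id)) : RegAction Tid Id → Prop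
  | .res .read v _ _ => v = some (regValue s)
  | .res .write v _ _ => v = none
  | a => ProperInvocation a

/-- The (sequential) specification of the register. -/
def regSpec (Tid : Type w) (Id : Type x) : Specification RegMethod ℕ Tid Id where
  carrier := {s | Sequential s ∧ ∀ s₁ a s₂, s = s₁ ++ a :: s₂ → RegAllowed s₁ a}
  sequential := fun _ hs => hs.1
  prefix_closed := by
    rintro s ⟨hs, hl⟩ t ht
    refine ⟨hs.of_prefix ht, ?_⟩
    rintro s₁ a s₂ rfl
    obtain ⟨u, rfl⟩ := ht
    exact hl s₁ a (s₂ ++ u) (by simp)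

/-- A register implementation: an implementation of the register object in which reads are
invoked without argument and writes are invoked with a value. -/
def IsRegisterImplementation {ι : Type y} {Q : Type z} (A : LTS Q (RegAction Tid Id ⊕ ι)) : Prop :=
  IsImplementation A ∧ ∀ e : A.Exec, ∀ a ∈ hist e, ProperInvocation a

/-- The class of decisively linearizable register implementations. -/
def DecisiveRegister {ι : Type y} {Q : Type z} (A : LTS Q (RegAction Tid Id ⊕ ι)) : Prop :=
  IsRegisterImplementation A ∧ DecisivelyLinearizable A (regSpec Tid Id)

end Registers

/-! ### The implementation `DR` -/

namespace DR

/-- Program locations: outside of any method (`main`); in a write: before `s ← Ver` (`wb`), before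
the store (`ww`), between roll back and roll forward (`wr`), before the return (`we`); in a read:
before the first load (`rb`), in the loop (`rl`), before the return (`re`). -/
inductive PC where
  | main | wb | ww | wr | we | rb | rl | re

/-- The states of `DR`.  `ids p` are the operation identifiers used by `p`, `vs p` is the set of
values collected by a read, `start p` is the version number found when the method started, and
`arg p` is the input or output of the method, also used as the temporary value of a write. -/
structure State (Tid : Type w) (Id : Type x) where
  val : ℕ
  ver : ℕ
  lock : Bool
  ids : Tid → List Id
  pc : Tid → PC
  vs : Tid → Set ℕ
  start : Tid → ℕ
  arg : Tid → ℕ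

open scoped Classical in
/-- The transitions of `DR`.  The internal label `Sum.inr p` is an internal step of thread `p`. -/
inductive Step {Tid : Type w} {Id : Type x} :
    State Tid Id → RegAction Tid Id ⊕ Tid → State Tid Id → Prop
  | readInv (q : State Tid Id) (p : Tid) (k : Id)
      (hpc : q.pc p = .main) (hk : k ∉ q.ids p) :
      Step q (.inl (.inv .read none p k))
        { q with
          pc := Function.update q.pc p .rb
          ids := Function.update q.ids p (q.ids p ++ [k]) }
  | readInit (q : State Tid Id) (p : Tid)
      (hpc : q.pc p = .rb) (hl : q.lock = false) :
      Step q (.inr p)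
        { q with
          pc := Function.update q.pc p .rl
          vs := Function.update q.vs p {q.val}
          start := Function.update q.start p q.ver }
  | readLoop (q : State Tid Id) (p : Tid)
      (hpc : q.pc p = .rl) (hv : q.val ∉ q.vs p) (hver : q.start p ≤ q.ver) :
      Step q (.inr p)
        { q with
          vs := Function.update q.vs p (insert q.val (q.vs p)) }
  | readPick (q : State Tid Id) (p : Tid) (out : ℕ)
      (hpc : q.pc p = .rl) (hout : out ∈ q.vs p) :
      Step q (.inr p)
        { q with
          pc := Function.update q.pc p .re
          arg := Function.update q.arg p out }
  | readRes (q : State Tid Id) (p : Tid) (k : Id)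
      (hpc : q.pc p = .re) (hk : (q.ids p).getLast? = some k) :
      Step q (.inl (.res .read (some (q.arg p)) p k))
        { q with
          pc := Function.update q.pc p .main
          vs := Function.update q.vs p ∅
          start := Function.update q.start p 0
          arg := Function.update q.arg p 0 }
  | writeInv (q : State Tid Id) (p : Tid) (k : Id) (v : ℕ)
      (hpc : q.pc p = .main) (hk : k ∉ q.ids p) :
      Step q (.inl (.inv .write (some v) p k))
        { q with
          ids := Function.update q.ids p (q.ids p ++ [k])
          pc := Function.update q.pc p .wb
          arg := Function.update q.arg p v }
  | writeInit (q : State Tid Id) (p : Tid)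
      (hpc : q.pc p = .wb) (hl : q.lock = false) :
      Step q (.inr p)
        { q with
          pc := Function.update q.pc p .ww
          start := Function.update q.start p q.ver }
  | writeTop (q : State Tid Id) (p : Tid)
      (hpc : q.pc p = .ww) (hl : q.lock = false) :
      Step q (.inr p)
        { q with
          val := q.arg p
          ver := q.ver + 1
          pc := Function.update q.pc p .we }
  | writeRollBack (q : State Tid Id) (p : Tid)
      (hpc : q.pc p = .ww) (hver : q.start p < q.ver) (hl : q.lock = false) :
      Step q (.inr p)
        { q with
          val := q.arg p
          ver := q.ver - 1
          lock := true
          pc := Function.update q.pc p .wr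
          arg := Function.update q.arg p q.val }
  | writeRollForward (q : State Tid Id) (p : Tid)
      (hpc : q.pc p = .wr) (hl : q.lock = true) :
      Step q (.inr p)
        { q with
          val := q.arg p
          ver := q.ver + 1
          lock := false
          pc := Function.update q.pc p .we }
  | writeRes (q : State Tid Id) (p : Tid) (k : Id)
      (hpc : q.pc p = .we) (hk : (q.ids p).getLast? = some k) :
      Step q (.inl (.res .write none p k))
        { q with
          pc := Function.update q.pc p .main
          vs := Function.update q.vs p ∅
          start := Function.update q.start p 0
          arg := Function.update q.arg p 0 }

end DR

/-- The register implementation `DR`. -/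
def dr (Tid : Type w) (Id : Type x) : LTS (DR.State Tid Id) (RegAction Tid Id ⊕ Tid) where
  init :=
    { val := 0
      ver := 0
      lock := false
      ids := fun _ => []
      pc := fun _ => .main
      vs := fun _ => ∅
      start := fun _ => 0
      arg := fun _ => 0 }
  step := DR.Step

end RegSim

/-! Linearizations are handled as lists of completed operations (`RegOp`, `OpLin`), and in both
halves of the proof such a list changes only by insertions. A pending operation may be inserted at a
cut of the list if every operation that returned before its invocation lies on the left (`DoneIn`).
The list stays legal if the inserted operation is a read of the value at the cut, or a write that is
last or directly followed by a write (`Insertable`).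

`DR` is decisively linearizable. Call a write executed by write-top a top write, and let `n` be
`Ver`, plus one while the lock is held. The invariant `Inv` keeps a linearization `A ++ C` where,
once `n` is positive, `C` starts with the last top write `w`. Write-top appends its write.
Write-roll-back inserts its write just before `w`, which overwrites it. Read-pick inserts its read
at a cut that was recorded when the value was collected. The test `start < n` certifies the cut
before `w`: the thread started before `w` was placed, and `w` was placed after everything then
present. `Inv.step` checks each transition, and `LTS.exists_monotone_choice` turns these steps into
one map on executions.

`DR` simulates every decisive `I`. The linearizations of `I` also grow only by insertions, and `DR`
follows them one at a time. An inserted write is a write-top if no write comes after it in the list,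
and a roll-back followed by a roll-forward otherwise (`SimInv.insert_write`). A roll-back may stand
for an insertion much deeper than just below the top: the state of `DR` remembers only the current
value and the values collected by readers. An inserted read costs nothing, since pending readers
stay in their loop, collect the values at all cuts still open to them, and pick one when they
respond.

A roll-back requires that `Ver` has grown since the write started, so a newly invoked write must
never have to go before a write that `DR` has already executed. The full linearization of `I` does
not ensure this, as it may end with operations that are still pending. `DR` therefore follows only
the part up to the last returned operation (`lagged`): a new operation comes after that one, hence
after the whole list. This is what `Late` records. It also shows that a reader for which some cut
before a write is open has `start < Ver`, and so can load the temporary value of a roll-back. -/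

namespace RegSim

universe u v w x y z

/-! ### Alternating and well-formed histories, extended by one action -/

section Histories

variable {M : Type u} {Val : Type v} {Tid : Type w} {Id : Type x}

theorem Action.isRes_eq_not_isInv (a : Action M Val Tid Id) : a.isRes = !a.isInv := by
  cases a <;> rfl

theorem Action.Matches.key_eq {i r : Action M Val Tid Id} (h : i.Matches r) : i.key = r.key := by
  simp [Action.key, h.2.2.2.1, h.2.2.2.2]

theorem Alternating.append_inv {s : List (Action M Val Tid Id)} {i : Action M Val Tid Id}
    (hs : Alternating s) (hi : i.isInv) (hl : ∀ a, s.getLast? = some a → a.isRes) :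
    Alternating (s ++ [i]) := by
  induction hs with
  | nil => exact .single i hi
  | single j hj =>
    have := hl j rfl
    simp [Action.isRes_eq_not_isInv, hj] at this
  | cons j r h hjr hh ih =>
    refine .cons j r _ hjr (ih fun a ha => hl a ?_)
    simp [List.getLast?_cons, ha]

theorem Alternating.append_res {s : List (Action M Val Tid Id)} {i r : Action M Val Tid Id}
    (hs : Alternating s) (hl : s.getLast? = some i) (hir : i.Matches r) :
    Alternating (s ++ [r]) := by
  induction hs with
  | nil => simp at hl
  | single j hj =>
    obtain rfl : j = i := by simpa using hl
    exact .cons j r [] hir .nil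
  | cons j r' h hjr hh ih =>
    refine .cons j r' _ hjr (ih ?_)
    cases h with
    | nil =>
      obtain rfl : r' = i := by simpa [List.getLast?_cons] using hl
      have h1 := hir.1
      have h2 := hjr.2.1
      simp [Action.isRes_eq_not_isInv, h1] at h2
    | cons b h => simpa [List.getLast?_cons] using hl

theorem Alternating.of_append_inv {s : List (Action M Val Tid Id)} {i : Action M Val Tid Id}
    (hs : Alternating (s ++ [i])) (hi : i.isInv) :
    ∀ a, s.getLast? = some a → a.isRes := by
  generalize ht : s ++ [i] = t at hs
  induction hs generalizing s with
  | nil => simp at ht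
  | single j hj =>
    cases s with
    | nil => simp
    | cons b s => simp at ht
  | cons j r h hjr hh ih =>
    match s with
    | [] => simp at ht
    | [b] =>
      obtain ⟨rfl, rfl, rfl⟩ : b = j ∧ i = r ∧ h = [] := by simpa [eq_comm] using ht
      have h2 := hjr.2.1
      simp [Action.isRes_eq_not_isInv, hi] at h2
    | b :: c :: s =>
      obtain ⟨rfl, rfl, hs'⟩ : b = j ∧ c = r ∧ s ++ [i] = h := by simpa using ht
      intro a ha
      cases s with
      | nil =>
        obtain rfl : c = a := by simpa [List.getLast?_cons] using ha
        exact hjr.2.1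
      | cons d s => exact ih hs' a (by simpa only [List.getLast?_cons_cons] using ha)

theorem Alternating.of_append_res {s : List (Action M Val Tid Id)} {r : Action M Val Tid Id}
    (hs : Alternating (s ++ [r])) (hr : r.isRes) :
    ∃ i, s.getLast? = some i ∧ i.Matches r := by
  generalize ht : s ++ [r] = t at hs
  induction hs generalizing s with
  | nil => simp at ht
  | single j hj =>
    cases s with
    | nil =>
      obtain rfl : r = j := by simpa using ht
      simp [Action.isRes_eq_not_isInv, hj] at hr
    | cons b s => simp at ht
  | cons j r' h hjr hh ih =>
    match s with
    | [] => simp at ht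
    | [b] =>
      obtain ⟨rfl, rfl, rfl⟩ : b = j ∧ r = r' ∧ h = [] := by simpa [eq_comm] using ht
      exact ⟨b, rfl, hjr⟩
    | b :: c :: s =>
      obtain ⟨rfl, rfl, hs'⟩ : b = j ∧ c = r' ∧ s ++ [r] = h := by simpa using ht
      obtain ⟨i, hi, hir⟩ := ih hs'
      refine ⟨i, ?_, hir⟩
      simp [List.getLast?_cons, hi]

/-- Only the last invocation of an alternating sequence can lack its response. Applied to one
thread, this says that an operation has returned or is the last action of its thread. -/
theorem Alternating.last_or_matched {s : List (Action M Val Tid Id)} (hs : Alternating s)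
    {i : Action M Val Tid Id} (hi : i.isInv) (his : i ∈ s) :
    s.getLast? = some i ∨ ∃ r ∈ s, i.Matches r := by
  induction hs with
  | nil => simp at his
  | single j hj =>
    obtain rfl : i = j := by simpa using his
    exact .inl rfl
  | cons j r h hjr hh ih =>
    rcases List.mem_cons.1 his with rfl | his
    · exact .inr ⟨r, by simp, hjr⟩
    rcases List.mem_cons.1 his with rfl | his
    · have h2 := hjr.2.1
      simp [Action.isRes_eq_not_isInv, hi] at h2
    rcases ih his with h1 | ⟨r', h1, h2⟩
    · left
      simp [List.getLast?_cons, h1]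
    · exact .inr ⟨r', by simp [h1], h2⟩

theorem Alternating.exists_inv {s : List (Action M Val Tid Id)} (hs : Alternating s)
    {r : Action M Val Tid Id} (hr : r.isRes) (hrs : r ∈ s) : ∃ i ∈ s, i.Matches r := by
  induction hs with
  | nil => simp at hrs
  | single j hj =>
    obtain rfl : r = j := by simpa using hrs
    simp [Action.isRes_eq_not_isInv, hj] at hr
  | cons j r' h hjr hh ih =>
    rcases List.mem_cons.1 hrs with rfl | hrs
    · have h2 := hjr.1
      simp [Action.isRes_eq_not_isInv, h2] at hr
    rcases List.mem_cons.1 hrs with rfl | hrs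
    · exact ⟨j, by simp, hjr⟩
    obtain ⟨i, h1, h2⟩ := ih hrs
    exact ⟨i, by simp [h1], h2⟩

/-- The action identifiers that the thread `p` has used in its invocations. -/
noncomputable def usedIds (h : List (Action M Val Tid Id)) (p : Tid) : List Id :=
  ((proj p h).filter Action.isInv).map Action.id

theorem mem_proj {h : List (Action M Val Tid Id)} {p : Tid} {a : Action M Val Tid Id} :
    a ∈ proj p h ↔ a ∈ h ∧ a.tid = p := by
  simp [proj]

theorem proj_append (p : Tid) (h h' : List (Action M Val Tid Id)) :
    proj p (h ++ h') = proj p h ++ proj p h' := by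
  simp [proj]

theorem proj_singleton_self (a : Action M Val Tid Id) : proj a.tid [a] = [a] := by
  simp [proj]

theorem proj_singleton_ne {p : Tid} {a : Action M Val Tid Id} (h : a.tid ≠ p) :
    proj p [a] = [] := by
  simp [proj, h]

theorem proj_snoc_self (h : List (Action M Val Tid Id)) (a : Action M Val Tid Id) :
    proj a.tid (h ++ [a]) = proj a.tid h ++ [a] := by
  rw [proj_append, proj_singleton_self]

theorem proj_snoc_ne (h : List (Action M Val Tid Id)) {p : Tid} {a : Action M Val Tid Id}
    (hp : a.tid ≠ p) : proj p (h ++ [a]) = proj p h := by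
  rw [proj_append, proj_singleton_ne hp, List.append_nil]

theorem usedIds_snoc_ne (h : List (Action M Val Tid Id)) {p : Tid} {a : Action M Val Tid Id}
    (hp : a.tid ≠ p) : usedIds (h ++ [a]) p = usedIds h p := by
  simp [usedIds, proj_snoc_ne h hp]

theorem usedIds_snoc_inv (h : List (Action M Val Tid Id)) {a : Action M Val Tid Id}
    (ha : a.isInv) : usedIds (h ++ [a]) a.tid = usedIds h a.tid ++ [a.id] := by
  simp [usedIds, proj_snoc_self, ha]

theorem usedIds_snoc_res (h : List (Action M Val Tid Id)) {a : Action M Val Tid Id}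
    (ha : a.isRes) (p : Tid) : usedIds (h ++ [a]) p = usedIds h p := by
  by_cases hp : a.tid = p
  · subst hp
    rw [Action.isRes_eq_not_isInv] at ha
    simp only [Bool.not_eq_true'] at ha
    simp [usedIds, proj_snoc_self, ha]
  · exact usedIds_snoc_ne h hp

theorem mem_usedIds {h : List (Action M Val Tid Id)} {i : Action M Val Tid Id}
    (hi : i.isInv) (hih : i ∈ h) : i.id ∈ usedIds h i.tid :=
  List.mem_map_of_mem (List.mem_filter.2 ⟨mem_proj.2 ⟨hih, rfl⟩, hi⟩)

theorem usedIds_getLast? {h : List (Action M Val Tid Id)} {p : Tid} {i : Action M Val Tid Id}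
    (hi : i.isInv) (hl : (proj p h).getLast? = some i) : (usedIds h p).getLast? = some i.id := by
  obtain ⟨s, hs⟩ := List.getLast?_eq_some_iff.1 hl
  simp [usedIds, hs, hi]

theorem mem_of_getLast? {h : List (Action M Val Tid Id)} {p : Tid} {i : Action M Val Tid Id}
    (hl : (proj p h).getLast? = some i) : i ∈ h :=
  (mem_proj.1 (List.mem_of_getLast? hl)).1

/-- For the actions of one thread, the keys of invocations are distinct exactly if their
identifiers are. -/
theorem nodup_key_proj_iff {h : List (Action M Val Tid Id)} {p : Tid} :
    (((proj p h).filter Action.isInv).map Action.key).Nodup ↔ (usedIds h p).Nodup := by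
  have : ((proj p h).filter Action.isInv).map Action.key = (usedIds h p).map (Prod.mk p) := by
    rw [usedIds, List.map_map]
    refine List.map_congr_left fun a ha => ?_
    have := (mem_proj.1 (List.mem_of_mem_filter ha)).2
    simp [Action.key, this]
  rw [this, List.nodup_map_iff (Prod.mk_right_injective p)]

theorem WellFormed.nodup_usedIds {h : List (Action M Val Tid Id)} (hw : WellFormed h) (p : Tid) :
    (usedIds h p).Nodup :=
  nodup_key_proj_iff.1 (hw p).2

theorem WellFormed.of_prefix {h h' : List (Action M Val Tid Id)} (hw : WellFormed h')
    (hp : h.IsPrefix h') : WellFormed h :=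
  fun p => (hw p).of_prefix (hp.filter _)

/-- Used in both directions: for `DR` the right side follows from the invariant, and for an
arbitrary implementation it is extracted from well-formedness. -/
theorem wellFormed_snoc_inv_iff {h : List (Action M Val Tid Id)} {a : Action M Val Tid Id}
    (ha : a.isInv) : WellFormed (h ++ [a]) ↔ WellFormed h ∧
      (∀ b, (proj a.tid h).getLast? = some b → b.isRes) ∧ a.id ∉ usedIds h a.tid := by
  constructor
  · intro hw
    have hp := hw a.tid
    have hn := hw.nodup_usedIds a.tid
    rw [proj_snoc_self] at hp
    rw [usedIds_snoc_inv h ha] at hn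
    exact ⟨hw.of_prefix (List.prefix_append _ _), hp.1.of_append_inv ha, fun hm =>
      (List.nodup_append.1 hn).2.2 _ hm _ (by simp) rfl⟩
  · rintro ⟨hw, hl, hid⟩ p
    by_cases hp : a.tid = p
    · subst hp
      refine ⟨?_, nodup_key_proj_iff.2 ?_⟩
      · rw [proj_snoc_self]
        exact (hw _).1.append_inv ha hl
      · rw [usedIds_snoc_inv h ha]
        refine List.nodup_append.2 ⟨hw.nodup_usedIds _, by simp, ?_⟩
        rintro b hb c hc rfl
        obtain rfl : b = a.id := by simpa using hc
        exact hid hb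
    · rw [proj_snoc_ne h hp]
      exact hw p

theorem wellFormed_snoc_res_iff {h : List (Action M Val Tid Id)} {a : Action M Val Tid Id}
    (ha : a.isRes) : WellFormed (h ++ [a]) ↔ WellFormed h ∧
      ∃ i, (proj a.tid h).getLast? = some i ∧ i.Matches a := by
  constructor
  · intro hw
    have hp := hw a.tid
    rw [proj_snoc_self] at hp
    exact ⟨hw.of_prefix (List.prefix_append _ _), hp.1.of_append_res ha⟩
  · rintro ⟨hw, i, hl, hi⟩ p
    refine ⟨?_, nodup_key_proj_iff.2 ?_⟩
    · by_cases hp : a.tid = p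
      · subst hp
        rw [proj_snoc_self]
        exact (hw _).1.append_res hl hi
      · rw [proj_snoc_ne h hp]
        exact (hw p).1
    · rw [usedIds_snoc_res h ha]
      exact hw.nodup_usedIds p

theorem WellFormed.inv_unique {h : List (Action M Val Tid Id)} (hw : WellFormed h)
    {i j : Action M Val Tid Id} (hi : i.isInv) (hj : j.isInv) (hih : i ∈ h) (hjh : j ∈ h)
    (hk : i.key = j.key) : i = j := by
  have ht : i.tid = j.tid := congrArg Prod.fst hk
  exact List.inj_on_of_nodup_map (hw i.tid).2
    (List.mem_filter.2 ⟨mem_proj.2 ⟨hih, rfl⟩, hi⟩)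
    (List.mem_filter.2 ⟨mem_proj.2 ⟨hjh, ht.symm⟩, hj⟩) hk

theorem WellFormed.exists_inv {h : List (Action M Val Tid Id)} (hw : WellFormed h)
    {r : Action M Val Tid Id} (hr : r.isRes) (hrh : r ∈ h) : ∃ i ∈ h, i.Matches r := by
  obtain ⟨i, hi, hm⟩ := (hw r.tid).1.exists_inv hr (mem_proj.2 ⟨hrh, rfl⟩)
  exact ⟨i, (mem_proj.1 hi).1, hm⟩

theorem sublist_pair_snoc_of_ne {α : Type*} {l : List α} {a b c : α} (h : [a, b].Sublist (l ++ [c]))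
    (hbc : b ≠ c) : [a, b].Sublist l := by
  obtain ⟨l₁, l₂, he, h₁, h₂⟩ := List.sublist_append_iff.1 h
  rcases List.sublist_singleton.1 h₂ with rfl | rfl
  · rw [List.append_nil] at he
    exact he ▸ h₁
  · have := congrArg List.getLast? he
    simp at this
    exact absurd this hbc

/-- Translates the order of two operations in a linearization into a statement about the cut just
before the second one, the form that `DoneIn` needs. -/
theorem mem_left_of_sublist_pair {α : Type*} {P Q : List α} {a b : α}
    (hn : (P ++ b :: Q).Nodup) (h : [a, b].Sublist (P ++ b :: Q)) : a ∈ P := by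
  induction P with
  | nil =>
    have hb : b ∉ Q := (List.nodup_cons.1 hn).1
    rcases List.cons_sublist_cons'.1 h with h | ⟨_, h⟩
    · exact absurd (h.subset (by simp)) hb
    · exact absurd (h.subset (by simp)) hb
  | cons c P ih =>
    rcases List.cons_sublist_cons'.1 h with h | ⟨rfl, _⟩
    · exact List.mem_cons_of_mem _ (ih (List.nodup_cons.1 hn).2 h)
    · simp

end Histories

/-- Completed register operations: a read with its output, or a write with its input. -/
inductive RegOp (Tid : Type w) (Id : Type x) where
  | read (p : Tid) (k : Id) (n : ℕ)
  | write (p : Tid) (k : Id) (n : ℕ)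

/-! ### Sequential register histories as lists of completed operations -/

namespace RegOp

variable {Tid : Type w} {Id : Type x}

def tid : RegOp Tid Id → Tid
  | read p _ _ => p
  | write p _ _ => p

def key : RegOp Tid Id → Tid × Id
  | read p k _ => (p, k)
  | write p k _ => (p, k)

def inv : RegOp Tid Id → RegAction Tid Id
  | read p k _ => .inv .read none p k
  | write p k n => .inv .write (some n) p k

def res : RegOp Tid Id → RegAction Tid Id
  | read p k n => .res .read (some n) p k
  | write p k _ => .res .write none p k

def IsWrite : RegOp Tid Id → Prop
  | read _ _ _ => False
  | write _ _ _ => True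

@[simp] theorem inv_isInv (x : RegOp Tid Id) : x.inv.isInv = true := by cases x <;> rfl
@[simp] theorem inv_isRes (x : RegOp Tid Id) : x.inv.isRes = false := by cases x <;> rfl
@[simp] theorem res_isInv (x : RegOp Tid Id) : x.res.isInv = false := by cases x <;> rfl
@[simp] theorem res_isRes (x : RegOp Tid Id) : x.res.isRes = true := by cases x <;> rfl
@[simp] theorem inv_key (x : RegOp Tid Id) : x.inv.key = x.key := by cases x <;> rfl
@[simp] theorem res_key (x : RegOp Tid Id) : x.res.key = x.key := by cases x <;> rfl
@[simp] theorem inv_tid (x : RegOp Tid Id) : x.inv.tid = x.tid := by cases x <;> rfl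
@[simp] theorem res_tid (x : RegOp Tid Id) : x.res.tid = x.tid := by cases x <;> rfl
@[simp] theorem key_fst (x : RegOp Tid Id) : x.key.1 = x.tid := by cases x <;> rfl

theorem inv_matches_res (x : RegOp Tid Id) : x.inv.Matches x.res := by
  cases x <;> simp [Action.Matches, inv, res, Action.isInv, Action.isRes, Action.method,
    Action.tid, Action.id]

theorem inv_ne_res (x y : RegOp Tid Id) : x.inv ≠ y.res := by
  cases x <;> cases y <;> simp [inv, res]

theorem ext_inv_res {x y : RegOp Tid Id} (hi : x.inv = y.inv) (hr : x.res = y.res) : x = y := by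
  cases x <;> cases y <;> simp_all [inv, res]

/-- The sequential history in which the operations of the list are executed one by one. -/
def flat (l : List (RegOp Tid Id)) : List (RegAction Tid Id) :=
  l.flatMap fun x => [x.inv, x.res]

@[simp] theorem flat_nil : flat ([] : List (RegOp Tid Id)) = [] := rfl

@[simp] theorem flat_cons (x : RegOp Tid Id) (l : List (RegOp Tid Id)) :
    flat (x :: l) = x.inv :: x.res :: flat l := rfl

theorem flat_append (l l' : List (RegOp Tid Id)) : flat (l ++ l') = flat l ++ flat l' :=
  List.flatMap_append

theorem mem_flat {l : List (RegOp Tid Id)} {a : RegAction Tid Id} :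
    a ∈ flat l ↔ ∃ x ∈ l, a = x.inv ∨ a = x.res := by
  simp [flat]

theorem inv_mem_flat {l : List (RegOp Tid Id)} {x : RegOp Tid Id} (hx : x ∈ l) :
    x.inv ∈ flat l := mem_flat.2 ⟨x, hx, .inl rfl⟩

theorem res_mem_flat {l : List (RegOp Tid Id)} {x : RegOp Tid Id} (hx : x ∈ l) :
    x.res ∈ flat l := mem_flat.2 ⟨x, hx, .inr rfl⟩

theorem filter_isInv_flat (l : List (RegOp Tid Id)) :
    (flat l).filter Action.isInv = l.map inv := by
  induction l with
  | nil => rfl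
  | cons x l ih => simp [ih]

theorem alternating_flat (l : List (RegOp Tid Id)) : Alternating (flat l) := by
  induction l with
  | nil => exact .nil
  | cons x l ih => exact .cons _ _ _ x.inv_matches_res ih

theorem map_key_filter_flat (l : List (RegOp Tid Id)) :
    ((flat l).filter Action.isInv).map Action.key = l.map key := by
  rw [filter_isInv_flat, List.map_map]
  exact List.map_congr_left fun x _ => x.inv_key

theorem sequential_flat_iff {l : List (RegOp Tid Id)} :
    Sequential (flat l) ↔ (l.map key).Nodup := by
  rw [Sequential, map_key_filter_flat]
  exact and_iff_right (alternating_flat l)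

theorem eq_of_key_eq {l : List (RegOp Tid Id)} (hn : (l.map key).Nodup) {x y : RegOp Tid Id}
    (hx : x ∈ l) (hy : y ∈ l) (hk : x.key = y.key) : x = y :=
  List.inj_on_of_nodup_map hn hx hy hk

theorem flat_eq_append_cons {l : List (RegOp Tid Id)} {s₁ s₂ : List (RegAction Tid Id)}
    {a : RegAction Tid Id} (h : flat l = s₁ ++ a :: s₂) :
    ∃ A x B, l = A ++ x :: B ∧
      ((s₁ = flat A ∧ a = x.inv) ∨ (s₁ = flat A ++ [x.inv] ∧ a = x.res)) := by
  induction l generalizing s₁ with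
  | nil => simp at h
  | cons z l ih =>
    rw [flat_cons] at h
    match s₁ with
    | [] =>
      rw [List.nil_append, List.cons_eq_cons] at h
      exact ⟨[], z, l, rfl, .inl ⟨rfl, h.1.symm⟩⟩
    | [b] =>
      rw [List.singleton_append, List.cons_eq_cons, List.cons_eq_cons] at h
      exact ⟨[], z, l, rfl, .inr ⟨by rw [h.1]; rfl, h.2.1.symm⟩⟩
    | b :: c :: s₁ =>
      rw [List.cons_append, List.cons_append, List.cons_eq_cons, List.cons_eq_cons] at h
      obtain ⟨rfl, rfl, h⟩ := h
      obtain ⟨A, x, B, rfl, hA⟩ := ih h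
      refine ⟨z :: A, x, B, rfl, ?_⟩
      simpa using hA

theorem pair_sublist_of_flat {l : List (RegOp Tid Id)} (hn : (l.map key).Nodup) {x y : RegOp Tid Id}
    (hx : x ∈ l) (hy : y ∈ l) (h : [x.res, y.inv].Sublist (flat l)) : [x, y].Sublist l := by
  induction l with
  | nil => simp at hx
  | cons z l ih =>
    have hn' := List.nodup_cons.1 hn
    rw [flat_cons] at h
    rcases List.cons_sublist_cons'.1 h with h | ⟨he, _⟩
    · rcases List.cons_sublist_cons'.1 h with h | ⟨he, hy'⟩
      -- The keys are distinct, so no action of the head `z` occurs again in `flat l`.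
      · have hfl : ∀ w : RegOp Tid Id, w ∈ z :: l → (w.inv ∈ flat l ∨ w.res ∈ flat l) → w ∈ l := by
          intro w hw hm
          rcases List.mem_cons.1 hw with rfl | hw
          · exfalso
            refine hn'.1 ?_
            rcases hm with hm | hm <;> obtain ⟨v, hv, hm⟩ := mem_flat.1 hm <;>
              refine List.mem_map.2 ⟨v, hv, ?_⟩ <;>
              rcases hm with hm | hm <;> simpa using (congrArg Action.key hm).symm
          · exact hw
        exact (ih hn'.2 (hfl x hx (.inr (h.subset (by simp))))
          (hfl y hy (.inl (h.subset (by simp)))) h).cons _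
      · have hxz : x = z := eq_of_key_eq hn hx (by simp) (by simpa using congrArg Action.key he)
        subst hxz
        refine List.Sublist.cons_cons _ (List.singleton_sublist.2 ?_)
        obtain ⟨v, hv, hm⟩ := mem_flat.1 (hy'.subset (List.mem_singleton_self _))
        rcases hm with hm | hm
        · have : y = v := eq_of_key_eq hn hy (by simp [hv]) (by simpa using congrArg Action.key hm)
          exact this ▸ hv
        · exact absurd hm (inv_ne_res _ _)
    · exact absurd he.symm (inv_ne_res _ _)

theorem flat_sublist_of_sublist {l l' : List (RegOp Tid Id)} (h : l.Sublist l') :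
    (flat l).Sublist (flat l') := by
  induction h with
  | slnil => simp
  | cons a _ ih => exact (ih.cons _).cons _
  | cons_cons a _ ih => exact (ih.cons_cons _).cons_cons _

/-- Comparing the invocations embeds the operations, except that the invocation of a read does not
determine its output. The output is recovered from the response, which also occurs in `flat l'` and
there belongs to the only operation with that key. -/
theorem sublist_of_flat_sublist {l l' : List (RegOp Tid Id)} (hn : (l'.map key).Nodup)
    (h : (flat l).Sublist (flat l')) : l.Sublist l' := by
  have h1 := h.filter Action.isInv
  rw [filter_isInv_flat, filter_isInv_flat] at h1
  obtain ⟨l₂, h2, h3⟩ := List.sublist_map_iff.1 h1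
  suffices l = l₂ from this ▸ h2
  have hinj : ∀ x ∈ l, ∀ y ∈ l₂, x.inv = y.inv → x = y := by
    intro x hx y hy hxy
    refine ext_inv_res hxy ?_
    obtain ⟨v, hv, hm⟩ := mem_flat.1 (h.subset (res_mem_flat hx))
    rcases hm with hm | hm
    · exact absurd hm.symm (inv_ne_res _ _)
    · have hk : v.key = y.key := by
        have h4 := congrArg Action.key hm
        have h5 := congrArg Action.key hxy
        simp only [inv_key, res_key] at h4 h5
        rw [← h4, h5]
      rw [hm, eq_of_key_eq hn hv (h2.subset hy) hk]
  clear h h1 h2 hn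
  induction l generalizing l₂ with
  | nil => exact (List.map_eq_nil_iff.1 h3.symm).symm
  | cons x l ih =>
    cases l₂ with
    | nil => simp at h3
    | cons y l₂ =>
      rw [List.map_cons, List.map_cons, List.cons_eq_cons] at h3
      rw [hinj x (by simp) y (by simp) h3.1,
        ih l₂ h3.2 fun a ha b hb => hinj a (by simp [ha]) b (by simp [hb])]

/-- The value of the register after executing the operations from the value `n`. -/
def valFrom (n : ℕ) : List (RegOp Tid Id) → ℕ
  | [] => n
  | read _ _ _ :: l => valFrom n l
  | write _ _ m :: l => valFrom m l

theorem valFrom_append (n : ℕ) (A B : List (RegOp Tid Id)) :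
    valFrom n (A ++ B) = valFrom (valFrom n A) B := by
  induction A generalizing n with
  | nil => rfl
  | cons x A ih => cases x <;> exact ih _

theorem valFrom_eq_of_exists {B : List (RegOp Tid Id)} (h : ∃ x ∈ B, x.IsWrite) (n m : ℕ) :
    valFrom n B = valFrom m B := by
  induction B with
  | nil => simp at h
  | cons x B ih =>
    cases x with
    | read p k l => exact ih (by simpa [IsWrite] using h)
    | write p k l => rfl

theorem valFrom_of_not_exists {B : List (RegOp Tid Id)} (h : ¬ ∃ x ∈ B, x.IsWrite) (n : ℕ) :
    valFrom n B = n := by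
  induction B with
  | nil => rfl
  | cons x B ih =>
    cases x with
    | read p k l => exact ih (by simpa [IsWrite] using h)
    | write p k l => simp [IsWrite] at h

/-- The value of the register after executing the operations from the initial value. -/
abbrev opVal (l : List (RegOp Tid Id)) : ℕ := valFrom 0 l

theorem regValue_append_flat (s : List (RegAction Tid Id)) (l : List (RegOp Tid Id)) :
    regValue (s ++ flat l) = valFrom (regValue s) l := by
  induction l generalizing s with
  | nil => simp [valFrom]
  | cons x l ih =>
    have : s ++ flat (x :: l) = (s ++ [x.inv, x.res]) ++ flat l := by simp
    rw [this, ih]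
    cases x <;> simp [regValue, valFrom, inv, res]

theorem regValue_flat (l : List (RegOp Tid Id)) : regValue (flat l) = opVal l :=
  regValue_append_flat [] l

/-- Each read of the sequence outputs the value of the register. -/
def Legal (l : List (RegOp Tid Id)) : Prop :=
  ∀ A p k n B, l = A ++ read p k n :: B → n = opVal A

theorem flat_mem_regSpec_iff {l : List (RegOp Tid Id)} :
    flat l ∈ (regSpec Tid Id).carrier ↔ (l.map key).Nodup ∧ Legal l := by
  constructor
  · rintro ⟨hs, hl⟩
    refine ⟨sequential_flat_iff.1 hs, ?_⟩
    rintro A p k n B rfl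
    have := hl (flat A ++ [(read p k n).inv]) (read p k n).res (flat B) (by simp [flat_append])
    have h2 : regValue (flat A ++ [(read p k n).inv]) = regValue (flat A) := by
      simp [regValue, inv]
    simpa [RegAllowed, res, h2, regValue_flat] using this
  · rintro ⟨hn, hl⟩
    refine ⟨sequential_flat_iff.2 hn, fun s₁ a s₂ h => ?_⟩
    obtain ⟨A, x, B, rfl, ⟨rfl, rfl⟩ | ⟨rfl, rfl⟩⟩ := flat_eq_append_cons h
    · cases x <;> simp [RegAllowed, inv, ProperInvocation]
    · cases x with
      | read p k n =>
        have h2 : regValue (flat A ++ [(read p k n).inv]) = regValue (flat A) := by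
          simp [regValue, inv]
        simp only [RegAllowed, res, h2, regValue_flat]
        rw [hl A p k n B rfl]
      | write p k n => simp [RegAllowed, res]

/-- A sequence of the register specification without pending operation comes from a list of
operations. -/
theorem exists_eq_flat {s : List (RegAction Tid Id)} (hs : Alternating s)
    (hn : ((s.filter Action.isInv).map Action.key).Nodup)
    (hc : ∀ i ∈ s, i.isInv → HasResponse s i)
    (hi : ∀ i ∈ s, i.isInv → ProperInvocation i)
    (hr : ∀ p k v, Action.res RegMethod.read v p k ∈ s → v ≠ none)
    (hw : ∀ p k v, Action.res RegMethod.write v p k ∈ s → v = none) :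
    ∃ l : List (RegOp Tid Id), s = flat l := by
  induction hs with
  | nil => exact ⟨[], rfl⟩
  | single i hi' =>
    obtain ⟨r, hr1, hr2, _⟩ := hc i (by simp) hi'
    obtain rfl : r = i := by simpa using hr1
    simp [Action.isRes_eq_not_isInv, hi'] at hr2
  | cons i r h hir hh ih =>
    have hrI : r.isInv = false := by simpa [Action.isRes_eq_not_isInv] using hir.2.1
    simp only [List.filter_cons, hir.1, hrI, if_true, List.map_cons, Bool.false_eq_true,
      if_false] at hn
    have hn' := List.nodup_cons.1 hn
    obtain ⟨l, rfl⟩ := ih hn'.2 (by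
      intro j hj hjI
      obtain ⟨r', h1, h2, h3⟩ := hc j (by simp [hj]) hjI
      refine ⟨r', ?_, h2, h3⟩
      rcases List.mem_cons.1 h1 with rfl | h1
      · have := hir.1
        simp [Action.isRes_eq_not_isInv, this] at h2
      rcases List.mem_cons.1 h1 with rfl | h1
      · refine absurd (List.mem_map.2 ⟨j, List.mem_filter.2 ⟨hj, hjI⟩, ?_⟩) hn'.1
        rw [hir.key_eq, h3]
      · exact h1) (fun j hj => hi j (by simp [hj])) (fun p k v hv => hr p k v (by simp [hv]))
      (fun p k v hv => hw p k v (by simp [hv]))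
    have hp := hi i (by simp) hir.1
    obtain ⟨h1, h2, h3, h4, h5⟩ := hir
    cases i with
    | res => simp [Action.isInv] at h1
    | inv m v p k =>
      cases r with
      | inv => simp [Action.isRes] at h2
      | res m' v' p' k' =>
        obtain rfl : m = m' := h3
        obtain rfl : p = p' := h4
        obtain rfl : k = k' := h5
        cases m with
        | read =>
          obtain rfl : v = none := hp
          obtain ⟨n, rfl⟩ := Option.ne_none_iff_exists'.1 (hr p k v' (by simp))
          exact ⟨read p k n :: l, rfl⟩
        | write =>
          obtain ⟨n, rfl⟩ : ∃ n, v = some n := hp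
          obtain rfl := hw p k v' (by simp)
          exact ⟨write p k n :: l, rfl⟩

end RegOp

open RegOp

/-! ### Linearizations in terms of operations -/

section Linearizations

variable {Tid : Type w} {Id : Type x}

/-- `l` is a linearization of `h`, in terms of operations. -/
structure OpLin (h : List (RegAction Tid Id)) (l : List (RegOp Tid Id)) : Prop where
  nodup : (l.map key).Nodup
  legal : Legal l
  inv_mem : ∀ x ∈ l, x.inv ∈ h
  status : ∀ x ∈ l, x.res ∈ h ∨ (proj x.tid h).getLast? = some x.inv
  res : ∀ r ∈ h, r.isRes → ∃ x ∈ l, x.res = r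
  order : ∀ x ∈ l, ∀ y ∈ l, [x.res, y.inv].Sublist h → [x, y].Sublist l

/-- Two different operations of `l` belong to different threads: both invocations would be the last
action of a common thread, hence have equal keys. So no response appended earlier affects the thread
of the next one. -/
theorem wellFormed_append_res {h : List (RegAction Tid Id)} (hw : WellFormed h)
    {l : List (RegOp Tid Id)} (hn : (l.map key).Nodup)
    (hp : ∀ x ∈ l, (proj x.tid h).getLast? = some x.inv) : WellFormed (h ++ l.map RegOp.res) := by
  induction l using List.reverseRecOn with
  | nil => simpa using hw
  | append_singleton l x ih =>
    rw [List.map_append, ← List.append_assoc, List.map_singleton, wellFormed_snoc_res_iff (by simp)]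
    have hn' := hn
    rw [List.map_append, List.nodup_append] at hn'
    refine ⟨ih hn'.1 fun y hy => hp y (by simp [hy]), x.inv, ?_, x.inv_matches_res⟩
    have : proj x.tid (l.map RegOp.res) = [] := by
      refine List.eq_nil_iff_forall_not_mem.2 fun a ha => ?_
      obtain ⟨ha, hat⟩ := mem_proj.1 ha
      obtain ⟨y, hy, rfl⟩ := List.mem_map.1 ha
      rw [res_tid] at hat
      have h1 := hp y (by simp [hy])
      rw [hat, hp x (by simp)] at h1
      have h2 : x.key = y.key := by simpa using congrArg Action.key (Option.some.inj h1)
      exact hn'.2.2 _ (List.mem_map_of_mem hy) _ (by simp) h2.symm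
    rw [res_tid, proj_append, this, List.append_nil]
    exact hp x (by simp)

theorem completed_sublist (h : List (RegAction Tid Id)) : (completed h).Sublist h :=
  List.filter_sublist

theorem mem_completed {h : List (RegAction Tid Id)} {a : RegAction Tid Id} :
    a ∈ completed h ↔ a ∈ h ∧ HasResponse h a := by
  simp [completed]

theorem mem_operations_completed {h : List (RegAction Tid Id)}
    {o : Operation RegMethod ℕ Tid Id} :
    o ∈ operations (completed h) ↔
      o.inv ∈ h ∧ o.inv.isInv ∧ ∃ r ∈ h, o.res = some r ∧ o.inv.Matches r := by
  constructor
  · rintro ⟨h1, h2, ⟨_, h3⟩ | ⟨r, h3, h4⟩⟩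
    · obtain ⟨_, r, hr, hr', hk⟩ := mem_completed.1 h1
      exact absurd ⟨r, mem_completed.2 ⟨hr, r, hr, hr', rfl⟩, hr', hk⟩ h3
    · exact ⟨(mem_completed.1 h1).1, h2, r, (mem_completed.1 h3).1, h4⟩
  · rintro ⟨h1, h2, r, hr, h3, h4⟩
    exact ⟨mem_completed.2 ⟨h1, r, hr, h4.2.1, h4.key_eq.symm⟩, h2,
      .inr ⟨r, mem_completed.2 ⟨hr, r, hr, h4.2.1, rfl⟩, h3, h4⟩⟩

theorem mem_operations_flat {l : List (RegOp Tid Id)} (hn : (l.map key).Nodup)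
    {o : Operation RegMethod ℕ Tid Id} :
    o ∈ operations (flat l) ↔ ∃ x ∈ l, o = ⟨x.inv, some x.res⟩ := by
  constructor
  · rintro ⟨h1, h2, h3⟩
    obtain ⟨x, hx, hx'⟩ := mem_flat.1 h1
    have hxi : o.inv = x.inv := by
      rcases hx' with hx' | hx'
      · exact hx'
      · simp [hx'] at h2
    rcases h3 with ⟨_, h3⟩ | ⟨r, h3, h4, h5⟩
    · exact absurd ⟨x.res, res_mem_flat hx, by simp, by simp [hxi]⟩ h3
    · obtain ⟨y, hy, hy'⟩ := mem_flat.1 h3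
      have hyr : r = y.res := by
        rcases hy' with rfl | hy'
        · simpa using h5.2.1
        · exact hy'
      have hk := h5.key_eq
      rw [hxi, hyr, inv_key, res_key] at hk
      obtain rfl := eq_of_key_eq hn hx hy hk
      refine ⟨x, hx, ?_⟩
      cases o
      simp_all
  · rintro ⟨x, hx, rfl⟩
    exact ⟨inv_mem_flat hx, by simp, .inr ⟨x.res, res_mem_flat hx, rfl, x.inv_matches_res⟩⟩

theorem OpLin.linearizedBy {h : List (RegAction Tid Id)} {l : List (RegOp Tid Id)}
    (hl : OpLin h l) (hw : WellFormed h) : LinearizedBy h (flat l) := by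
  classical
  -- The operations that the linearization contains although they are pending; their responses
  -- complete `h`.
  set l₁ := l.filter (fun x => x.res ∉ h) with hl₁
  have hmem : ∀ x, x ∈ l₁ ↔ x ∈ l ∧ x.res ∉ h := by simp [hl₁]
  have hops : ∀ o, o ∈ operations (completed (h ++ l₁.map RegOp.res)) ↔
      ∃ x ∈ l, o = ⟨x.inv, some x.res⟩ := by
    intro o
    rw [mem_operations_completed]
    constructor
    · rintro ⟨h1, h2, r, h3, h4, h5⟩
      obtain ⟨x, hx, rfl⟩ : ∃ x ∈ l, x.res = r := by
        rcases List.mem_append.1 h3 with h3 | h3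
        · exact hl.res r h3 h5.2.1
        · obtain ⟨x, hx, rfl⟩ := List.mem_map.1 h3
          exact ⟨x, ((hmem x).1 hx).1, rfl⟩
      refine ⟨x, hx, ?_⟩
      have hoh : o.inv ∈ h := by
        rcases List.mem_append.1 h1 with h1 | h1
        · exact h1
        · obtain ⟨y, _, hy⟩ := List.mem_map.1 h1
          simp [← hy] at h2
      have := hw.inv_unique h2 x.inv_isInv hoh (hl.inv_mem x hx) (by simpa using h5.key_eq)
      cases o
      simp_all
    · rintro ⟨x, hx, rfl⟩
      refine ⟨List.mem_append_left _ (hl.inv_mem x hx), by simp, x.res, ?_, rfl, x.inv_matches_res⟩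
      by_cases hxh : x.res ∈ h
      · exact List.mem_append_left _ hxh
      · exact List.mem_append_right _ (List.mem_map_of_mem ((hmem x).2 ⟨hx, hxh⟩))
  refine ⟨sequential_flat_iff.2 hl.nodup, l₁.map RegOp.res, ?_, ?_, ?_, ?_⟩
  · intro r hr
    obtain ⟨x, _, rfl⟩ := List.mem_map.1 hr
    simp
  · refine wellFormed_append_res hw (hl.nodup.sublist (List.filter_sublist.map _)) fun x hx => ?_
    exact (hl.status x ((hmem x).1 hx).1).resolve_left ((hmem x).1 hx).2
  · ext o
    rw [hops, mem_operations_flat hl.nodup]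
  · intro o₁ h₁ o₂ h₂ ⟨r, hr, hs⟩
    obtain ⟨x, hx, rfl⟩ := (hops _).1 h₁
    obtain ⟨y, hy, rfl⟩ := (hops _).1 h₂
    obtain rfl : x.res = r := by simpa using hr
    refine ⟨x.res, rfl, ?_⟩
    -- The appended actions are responses, so a pair that ends with an invocation already lies in
    -- `h`.
    have hs' : [x.res, y.inv].Sublist h := by
      have := hs.trans (completed_sublist _)
      obtain ⟨m₁, m₂, he, hm₁, hm₂⟩ := List.sublist_append_iff.1 this
      cases m₂ using List.reverseRecOn with
      | nil => simpa [he] using hm₁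
      | append_singleton m₂ b =>
        have hb := congrArg List.getLast? he
        rw [← List.append_assoc] at hb
        simp at hb
        obtain ⟨z, _, hz⟩ := List.mem_map.1 (hm₂.subset (List.mem_append_right _ (List.mem_singleton_self b)))
        exact absurd (hb.trans hz.symm) (inv_ne_res _ _)
    have h3 := flat_sublist_of_sublist (hl.order x hx y hy hs')
    refine List.Sublist.trans ?_ h3
    simp only [flat_cons]
    exact .cons _ (.cons_cons _ (.cons_cons _ (by simp)))

/-- A completed history has no pending operations, so neither has `s`, and its invocations and
responses pair up. Appended responses cannot supply an invocation, so all invocations come from `h`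
itself. -/
theorem exists_opLin {h s : List (RegAction Tid Id)} (hw : WellFormed h)
    (hs : s ∈ (regSpec Tid Id).carrier) (hl : LinearizedBy h s) :
    ∃ l : List (RegOp Tid Id), s = flat l ∧ OpLin h l := by
  obtain ⟨hseq, rs, hrs, hwr, hop, hrt⟩ := hl
  have hall : ∀ a ∈ s, ∃ s₁, RegAllowed s₁ a := by
    intro a ha
    obtain ⟨s₁, s₂, rfl⟩ := List.append_of_mem ha
    exact ⟨s₁, hs.2 s₁ a s₂ rfl⟩
  obtain ⟨l, rfl⟩ : ∃ l : List (RegOp Tid Id), s = flat l := by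
    refine exists_eq_flat hseq.1 hseq.2 ?_ ?_ ?_ ?_
    · intro i his hi
      by_contra hn
      have : (⟨i, none⟩ : Operation RegMethod ℕ Tid Id) ∈ operations s :=
        ⟨his, hi, .inl ⟨rfl, hn⟩⟩
      rw [← hop, mem_operations_completed] at this
      simp at this
    · intro i his hi
      obtain ⟨s₁, h₁⟩ := hall i his
      cases i with
      | inv m v p k => cases m <;> exact h₁
      | res => simp [Action.isInv] at hi
    · intro p k v hv
      obtain ⟨s₁, h₁⟩ := hall _ hv
      have h₁ : v = some _ := h₁
      simp [h₁]
    · intro p k v hv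
      obtain ⟨s₁, h₁⟩ := hall _ hv
      exact h₁
  obtain ⟨hn, hlegal⟩ := flat_mem_regSpec_iff.1 hs
  have hopx : ∀ x ∈ l, (⟨x.inv, some x.res⟩ : Operation RegMethod ℕ Tid Id) ∈
      operations (completed (h ++ rs)) := by
    intro x hx
    rw [hop, mem_operations_flat hn]
    exact ⟨x, hx, rfl⟩
  have hinv : ∀ x ∈ l, x.inv ∈ h := by
    intro x hx
    rcases List.mem_append.1 (mem_operations_completed.1 (hopx x hx)).1 with h1 | h1
    · exact h1
    · simpa using hrs _ h1
  have hres : ∀ r ∈ h, r.isRes → ∃ x ∈ l, x.res = r := by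
    intro r hr hr'
    obtain ⟨i, hi, hm⟩ := hw.exists_inv hr' hr
    have : (⟨i, some r⟩ : Operation RegMethod ℕ Tid Id) ∈ operations (flat l) := by
      rw [← hop, mem_operations_completed]
      exact ⟨List.mem_append_left _ hi, hm.1, r, List.mem_append_left _ hr, rfl, hm⟩
    obtain ⟨x, hx, he⟩ := (mem_operations_flat hn).1 this
    exact ⟨x, hx, by simpa using (congrArg Operation.res he).symm⟩
  refine ⟨l, rfl, hn, hlegal, hinv, ?_, hres, ?_⟩
  · intro x hx
    rcases (hw x.tid).1.last_or_matched x.inv_isInv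
      (mem_proj.2 ⟨hinv x hx, x.inv_tid⟩) with h1 | ⟨r, h1, h2⟩
    · exact .inr h1
    · obtain ⟨y, hy, rfl⟩ := hres r (mem_proj.1 h1).1 h2.2.1
      obtain rfl := eq_of_key_eq hn hx hy (by simpa using h2.key_eq)
      exact .inl (mem_proj.1 h1).1
  · intro x hx y hy hxy
    have hc : [x.res, y.inv].Sublist (completed (h ++ rs)) := by
      -- The explicit instance is the classical one in the definition of `completed`.
      have h1 := (hxy.trans (List.sublist_append_left h rs)).filter
        (fun a => @decide (HasResponse (h ++ rs) a) (Classical.propDecidable _))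
      have h2 : ∀ z ∈ l, HasResponse (h ++ rs) z.res ∧ HasResponse (h ++ rs) z.inv := by
        intro z hz
        obtain ⟨_, _, r, hr, he, _⟩ := mem_operations_completed.1 (hopx z hz)
        obtain rfl : z.res = r := by simpa using he
        exact ⟨⟨z.res, hr, by simp, rfl⟩, ⟨z.res, hr, by simp, by simp⟩⟩
      rwa [List.filter_eq_self.2 (by simp [h2 x hx, h2 y hy])] at h1
    obtain ⟨r, hr, hs'⟩ := hrt _ (hopx x hx) _ (hopx y hy) ⟨x.res, rfl, hc⟩
    obtain rfl : x.res = r := by simpa using hr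
    exact pair_sublist_of_flat hn hx hy hs'

end Linearizations

/-! ### Executions and choices that are monotone along prefixes -/

section Executions

variable {Q : Type u} {Lab : Type v}

/-- The state reached by a path from `q`. -/
def LTS.endState (q : Q) (e : List (Q × Lab × Q)) : Q :=
  e.foldl (fun _ t => t.2.2) q

@[simp] theorem LTS.endState_snoc (q : Q) (e : List (Q × Lab × Q)) (t : Q × Lab × Q) :
    LTS.endState q (e ++ [t]) = t.2.2 := by
  simp [LTS.endState]

theorem LTS.isPath_snoc_iff (A : LTS Q Lab) (q : Q) (e : List (Q × Lab × Q)) (t : Q × Lab × Q) :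
    A.IsPath q (e ++ [t]) ↔
      A.IsPath q e ∧ t.1 = LTS.endState q e ∧ A.step t.1 t.2.1 t.2.2 := by
  induction e generalizing q with
  | nil => simp [LTS.IsPath, LTS.endState]
  | cons s e ih =>
    simp only [List.cons_append, LTS.IsPath, ih, LTS.endState, List.foldl_cons, and_assoc]

/-- A property that can be kept along transitions, while moving up in a preorder, is satisfied by
a function of the executions that is monotone with respect to prefixes. -/
theorem LTS.exists_monotone_choice (A : LTS Q Lab) {α : Type*} (r : α → α → Prop)
    (hr : ∀ a, r a a) (ht : ∀ a b c, r a b → r b c → r a c)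
    (P : List (Q × Lab × Q) → α → Prop) (a₀ : α) (h₀ : P [] a₀)
    (hs : ∀ e t a, A.IsPath A.init (e ++ [t]) → P e a → ∃ b, P (e ++ [t]) b ∧ r a b) :
    ∃ F : A.Exec → α, (∀ e, P e.1 (F e)) ∧
      ∀ e₁ e₂ : A.Exec, e₁.1.IsPrefix e₂.1 → r (F e₁) (F e₂) := by
  classical
  -- The recursion is on the reversed execution, whose head is the last transition. The fallback `a`
  -- is never used along a path.
  let f : List (Q × Lab × Q) → α := fun l => l.rec a₀ fun t l a =>
    if h : ∃ b, P (l.reverse ++ [t]) b ∧ r a b then h.choose else a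
  have hstep : ∀ e t, A.IsPath A.init (e ++ [t]) → P e (f e.reverse) →
      P (e ++ [t]) (f (e ++ [t]).reverse) ∧ r (f e.reverse) (f (e ++ [t]).reverse) := by
    intro e t hp he
    have hex : ∃ b, P (e.reverse.reverse ++ [t]) b ∧ r (f e.reverse) b := by
      rw [List.reverse_reverse]
      exact hs e t _ hp he
    have hf : f (e ++ [t]).reverse = hex.choose := by
      rw [List.reverse_append]
      exact dif_pos hex
    have := hex.choose_spec
    rw [← hf, List.reverse_reverse] at this
    exact this
  have hP : ∀ e, A.IsPath A.init e → P e (f e.reverse) := by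
    intro e
    induction e using List.reverseRecOn with
    | nil => exact fun _ => h₀
    | append_singleton e t ih =>
      exact fun hp => (hstep e t hp (ih ((A.isPath_snoc_iff _ _ _).1 hp).1)).1
  refine ⟨fun e => f e.1.reverse, fun e => hP e.1 e.2, ?_⟩
  rintro ⟨e₁, h₁⟩ ⟨e₂, h₂⟩ ⟨u, hu⟩
  dsimp only at hu ⊢
  subst hu
  clear h₁
  induction u using List.reverseRecOn with
  | nil => rw [List.append_nil]; exact hr _
  | append_singleton u t ih =>
    rw [← List.append_assoc] at h₂ ⊢
    have h₃ := ((A.isPath_snoc_iff _ _ _).1 h₂).1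
    exact ht _ _ _ (ih h₃) (hstep _ _ h₂ (hP _ h₃)).2

/-- The history of a sequence of transitions. -/
def histOf {Act : Type*} {ι : Type*} (e : List (Q × (Act ⊕ ι) × Q)) : List Act :=
  (e.map fun t => t.2.1).filterMap Sum.getLeft?

@[simp] theorem histOf_snoc {Act : Type*} {ι : Type*} (e : List (Q × (Act ⊕ ι) × Q))
    (t : Q × (Act ⊕ ι) × Q) :
    histOf (e ++ [t]) = histOf e ++ [t.2.1].filterMap Sum.getLeft? := by
  simp [histOf]

end Executions

/-! ### Inserting a pending operation into a linearization -/

section Insertion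

variable {Tid : Type w} {Id : Type x}

/-- The operation `z` may be inserted between `P` and `S`: it is a read of the current value, or
a write such that the next operation, if any, is a write. -/
def Insertable (P : List (RegOp Tid Id)) (z : RegOp Tid Id) (S : List (RegOp Tid Id)) : Prop :=
  (∃ p k, z = .read p k (opVal P)) ∨ (z.IsWrite ∧ ∀ w ∈ S.head?, w.IsWrite)

/-- A read does not affect the value, and a write is overwritten at once by the head of `a`. The
only exception is a write with the cut directly behind it. -/
theorem Insertable.opVal_eq {P S a S₁ : List (RegOp Tid Id)} {z : RegOp Tid Id}
    (h : Insertable P z S) (hS : S = a ++ S₁) (ha : a ≠ [] ∨ ¬ z.IsWrite) :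
    opVal (P ++ z :: a) = opVal (P ++ a) := by
  rw [opVal, opVal, valFrom_append, valFrom_append]
  rcases h with ⟨p, k, rfl⟩ | ⟨hz, hw⟩
  · rfl
  · have ha := ha.resolve_right (not_not.2 hz)
    cases a with
    | nil => exact absurd rfl ha
    | cons w a =>
      have : w.IsWrite := hw w (by simp [hS])
      cases z with
      | read => exact absurd hz id
      | write p k n => exact valFrom_eq_of_exists (B := w :: a) ⟨w, by simp, this⟩ n _

theorem Insertable.legal {P S : List (RegOp Tid Id)} {z : RegOp Tid Id}
    (h : Insertable P z S) (hl : Legal (P ++ S)) : Legal (P ++ z :: S) := by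
  intro A p k n B he
  rcases List.append_eq_append_iff.1 he with ⟨a, rfl, h2⟩ | ⟨c, rfl, h2⟩
  · cases a with
    | nil =>
      obtain ⟨rfl, rfl⟩ := List.cons_eq_cons.1 h2
      rcases h with ⟨p', k', h⟩ | ⟨h, _⟩
      · rw [List.append_nil]
        injection h
      · exact absurd h id
    | cons b a =>
      obtain ⟨rfl, rfl⟩ := List.cons_eq_cons.1 h2
      rw [h.opVal_eq rfl]
      · exact hl _ p k n B (by simp)
      · rcases h with ⟨p', k', rfl⟩ | ⟨_, h⟩
        · exact .inr id
        · left
          rintro rfl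
          -- If `a` were empty, this read would directly follow the write `z`.
          exact h (.read p k n) (by simp)
  · cases c with
    | nil =>
      obtain ⟨rfl, rfl⟩ := List.cons_eq_cons.1 h2
      rcases h with ⟨p', k', h⟩ | ⟨h, _⟩
      · rw [List.append_nil] at h
        injection h
      · exact absurd h id
    | cons b c =>
      obtain ⟨rfl, rfl⟩ := List.cons_eq_cons.1 h2
      exact hl A p k n (c ++ S) (by simp)

/-- Keeps the values collected by readers justified: each old cut has a counterpart with the same
value and at least the same operations on its left. -/
theorem Insertable.exists_split {P S : List (RegOp Tid Id)} {z : RegOp Tid Id}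
    (h : Insertable P z S) {P₁ S₁ : List (RegOp Tid Id)} (he : P ++ S = P₁ ++ S₁) :
    ∃ P' S', P ++ z :: S = P' ++ S' ∧ opVal P' = opVal P₁ ∧ ∀ x ∈ P₁, x ∈ P' := by
  rcases List.append_eq_append_iff.1 he with ⟨a, rfl, rfl⟩ | ⟨c, rfl, rfl⟩
  · by_cases ha : a = []
    · subst ha
      -- A cut exactly at the insertion point stays on the left of `z`, where the value is the old
      -- one.
      exact ⟨P, z :: S₁, by simp, by simp, by simp⟩
    · refine ⟨P ++ z :: a, S₁, by simp, h.opVal_eq rfl (.inl ha), ?_⟩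
      intro x hx
      rcases List.mem_append.1 hx with hx | hx <;> simp [hx]
  · exact ⟨P₁, c ++ z :: S, by simp, rfl, fun _ => id⟩

/-- Among the operations of `l`, those that return before `i` belong to `A`. -/
def DoneIn (h : List (RegAction Tid Id)) (i : RegAction Tid Id) (l A : List (RegOp Tid Id)) : Prop :=
  ∀ x ∈ l, [x.res, i].Sublist h → x ∈ A

theorem DoneIn.snoc {h : List (RegAction Tid Id)} {i a : RegAction Tid Id}
    {l A : List (RegOp Tid Id)} (hd : DoneIn h i l A) (ha : i ≠ a) : DoneIn (h ++ [a]) i l A :=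
  fun x hx hs => hd x hx (sublist_pair_snoc_of_ne hs ha)

theorem OpLin.res_notMem {h : List (RegAction Tid Id)} {l : List (RegOp Tid Id)} (hl : OpLin h l)
    {z : RegOp Tid Id} (hz : ∀ x ∈ l, x.key ≠ z.key) : z.res ∉ h := by
  intro hr
  obtain ⟨x, hx, he⟩ := hl.res _ hr (by simp)
  exact hz x hx (by simpa using congrArg Action.key he)

/-- Since `z` has not returned, it precedes nothing in real time. The only new order constraints
concern the operations that returned before its invocation, and these are in `P`. -/
theorem OpLin.insert {h : List (RegAction Tid Id)} {P S : List (RegOp Tid Id)}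
    (hl : OpLin h (P ++ S)) {z : RegOp Tid Id} (hz : ∀ x ∈ P ++ S, x.key ≠ z.key)
    (hp : (proj z.tid h).getLast? = some z.inv) (hd : DoneIn h z.inv (P ++ S) P)
    (hi : Insertable P z S) : OpLin h (P ++ z :: S) := by
  have hmem : ∀ x, x ∈ P ++ z :: S ↔ x = z ∨ x ∈ P ++ S := by
    intro x
    simp only [List.mem_append, List.mem_cons]
    tauto
  have hsub : (P ++ S).Sublist (P ++ z :: S) :=
    (List.Sublist.refl P).append (List.sublist_cons_self _ _)
  refine ⟨?_, hi.legal hl.legal, ?_, ?_, ?_, ?_⟩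
  · have : (P ++ z :: S).Perm (z :: (P ++ S)) := List.perm_middle
    rw [(this.map key).nodup_iff, List.map_cons, List.nodup_cons]
    refine ⟨fun hm => ?_, hl.nodup⟩
    obtain ⟨x, hx, hk⟩ := List.mem_map.1 hm
    exact hz x hx hk
  · intro x hx
    rcases (hmem x).1 hx with rfl | hx
    · exact mem_of_getLast? hp
    · exact hl.inv_mem x hx
  · intro x hx
    rcases (hmem x).1 hx with rfl | hx
    · exact .inr hp
    · exact hl.status x hx
  · intro r hr hr'
    obtain ⟨x, hx, he⟩ := hl.res r hr hr'
    exact ⟨x, (hmem x).2 (.inr hx), he⟩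
  · intro x hx y hy hs
    rcases (hmem x).1 hx with rfl | hx'
    · exact absurd (hs.subset (by simp)) (hl.res_notMem hz)
    rcases (hmem y).1 hy with rfl | hy'
    · have := hd x hx' hs
      exact (List.singleton_sublist.2 this).append (List.singleton_sublist.2 (by simp) :
        [y].Sublist (y :: S))
    · exact (hl.order x hx' y hy' hs).trans hsub

theorem OpLin.key_ne_of_notMem {h : List (RegAction Tid Id)} {l : List (RegOp Tid Id)}
    (hl : OpLin h l) {p : Tid} {k : Id} (hk : k ∉ usedIds h p) : ∀ x ∈ l, x.key ≠ (p, k) := by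
  intro x hx he
  have := mem_usedIds x.inv_isInv (hl.inv_mem x hx)
  have h2 : x.inv.key = (p, k) := by simpa using he
  obtain ⟨rfl, rfl⟩ : x.inv.tid = p ∧ x.inv.id = k := by simpa [Action.key] using h2
  exact hk this

/-- The invocation is fresh, so it belongs to no operation of `l` and creates no order among them.
-/
theorem OpLin.snoc_inv {h : List (RegAction Tid Id)} {l : List (RegOp Tid Id)} (hl : OpLin h l)
    {a : RegAction Tid Id} (ha : a.isInv) (hw : WellFormed (h ++ [a])) : OpLin (h ++ [a]) l := by
  obtain ⟨_, hlast, hid⟩ := (wellFormed_snoc_inv_iff ha).1 hw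
  refine ⟨hl.nodup, hl.legal, fun x hx => List.mem_append_left _ (hl.inv_mem x hx), ?_, ?_, ?_⟩
  · intro x hx
    rcases hl.status x hx with h1 | h1
    · exact .inl (List.mem_append_left _ h1)
    · right
      rw [proj_snoc_ne, h1]
      intro hne
      rw [← hne] at h1
      simpa using hlast _ h1
  · intro r hr hr'
    rcases List.mem_append.1 hr with hr | hr
    · exact hl.res r hr hr'
    · obtain rfl : r = a := by simpa using hr
      simp [Action.isRes_eq_not_isInv, ha] at hr'
  · intro x hx y hy hs
    refine hl.order x hx y hy (sublist_pair_snoc_of_ne hs ?_)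
    rintro rfl
    exact hid (mem_usedIds ha (hl.inv_mem y hy))

theorem OpLin.snoc_res {h : List (RegAction Tid Id)} {l : List (RegOp Tid Id)} (hl : OpLin h l)
    {z : RegOp Tid Id} (hz : z ∈ l) (hp : (proj z.tid h).getLast? = some z.inv) :
    OpLin (h ++ [z.res]) l := by
  refine ⟨hl.nodup, hl.legal, fun x hx => List.mem_append_left _ (hl.inv_mem x hx), ?_, ?_, ?_⟩
  · intro x hx
    by_cases hxz : x = z
    · subst hxz
      exact .inl (by simp)
    rcases hl.status x hx with h1 | h1
    · exact .inl (List.mem_append_left _ h1)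
    · right
      rw [proj_snoc_ne, h1]
      rw [res_tid]
      intro hne
      rw [← hne, hp] at h1
      exact hxz (eq_of_key_eq hl.nodup hx hz
        (by simpa using (congrArg Action.key (Option.some.inj h1)).symm))
  · intro r hr hr'
    rcases List.mem_append.1 hr with hr | hr
    · exact hl.res r hr hr'
    · exact ⟨z, hz, (List.mem_singleton.1 hr).symm⟩
  · intro x hx y hy hs
    exact hl.order x hx y hy (sublist_pair_snoc_of_ne hs (inv_ne_res _ _))

end Insertion

/-! ### `DR` is a decisively linearizable register implementation -/

namespace DR

variable {Tid : Type w} {Id : Type x}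

/-- What the local state of the thread `p` says about the history `h` and its linearization
`A ++ C`, where `C` starts with the last of the `n` writes that were not rolled back over. -/
def LocalInv (h : List (RegAction Tid Id)) (A C : List (RegOp Tid Id)) (lock : Bool) (n : ℕ)
    (p : Tid) (vs : Set ℕ) (start arg : ℕ) : PC → Prop
  | .main => ∀ a, (proj p h).getLast? = some a → a.isRes
  | .rb => ∃ k, (proj p h).getLast? = some (.inv .read none p k) ∧ ∀ x ∈ A ++ C, x.key ≠ (p, k)
  | .rl => ∃ k, (proj p h).getLast? = some (.inv .read none p k) ∧
      (∀ x ∈ A ++ C, x.key ≠ (p, k)) ∧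
      (start < n → DoneIn h (.inv .read none p k) (A ++ C) A) ∧
      ∀ v ∈ vs, ∃ P S, A ++ C = P ++ S ∧ opVal P = v ∧
        DoneIn h (.inv .read none p k) (A ++ C) P
  | .re => ∃ k, (proj p h).getLast? = some (.inv .read none p k) ∧ .read p k arg ∈ A ++ C
  | .wb => ∃ k, (proj p h).getLast? = some (.inv .write (some arg) p k) ∧
      ∀ x ∈ A ++ C, x.key ≠ (p, k)
  | .ww => ∃ k, (proj p h).getLast? = some (.inv .write (some arg) p k) ∧
      (∀ x ∈ A ++ C, x.key ≠ (p, k)) ∧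
      (start < n → DoneIn h (.inv .write (some arg) p k) (A ++ C) A)
  | .wr => ∃ k v, (proj p h).getLast? = some (.inv .write (some v) p k) ∧
      .write p k v ∈ A ++ C ∧ arg = opVal (A ++ C) ∧ lock = true
  | .we => ∃ k v, (proj p h).getLast? = some (.inv .write (some v) p k) ∧ .write p k v ∈ A ++ C

/-- Collects what a step of another thread has to guarantee: new operations are pending ones of
other threads, old ones remain, open cuts survive with their values, and the value saved by the lock
holder is still the final one. -/
theorem LocalInv.mono {h : List (RegAction Tid Id)} {A C A' C' : List (RegOp Tid Id)}
    {lock lock' : Bool} {n n' : ℕ} {p : Tid} {vs : Set ℕ} {start arg : ℕ} {pc : PC}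
    (hL : LocalInv h A C lock n p vs start arg pc)
    (hz : ∀ x ∈ A' ++ C', x ∈ A ++ C ∨ (x.tid ≠ p ∧ x.res ∉ h))
    (hsub : ∀ x ∈ A ++ C, x ∈ A' ++ C')
    (hval : pc = .wr → lock = true → lock' = true ∧ opVal (A' ++ C') = opVal (A ++ C))
    (hdone : ∀ i s, (s < n → DoneIn h i (A ++ C) A) → s < n' → DoneIn h i (A' ++ C') A')
    (hsplit : ∀ P S, A ++ C = P ++ S →
      ∃ P' S', A' ++ C' = P' ++ S' ∧ opVal P' = opVal P ∧ ∀ x ∈ P, x ∈ P') :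
    LocalInv h A' C' lock' n' p vs start arg pc := by
  have hfresh : ∀ k, (∀ x ∈ A ++ C, x.key ≠ (p, k)) → ∀ x ∈ A' ++ C', x.key ≠ (p, k) := by
    intro k hk x hx he
    rcases hz x hx with hx | ⟨hx, _⟩
    · exact hk x hx he
    · exact hx (by rw [← key_fst, he])
  cases pc with
  | main => exact hL
  | rb =>
    obtain ⟨k, h1, h2⟩ := hL
    exact ⟨k, h1, hfresh k h2⟩
  | rl =>
    obtain ⟨k, h1, h2, h3, h4⟩ := hL
    refine ⟨k, h1, hfresh k h2, hdone _ _ h3, fun v hv => ?_⟩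
    obtain ⟨P, S, h5, h6, h7⟩ := h4 v hv
    obtain ⟨P', S', h8, h9, h10⟩ := hsplit P S h5
    refine ⟨P', S', h8, h9.trans h6, fun x hx hs => ?_⟩
    rcases hz x hx with hx | ⟨_, hx⟩
    · exact h10 x (h7 x hx hs)
    · exact absurd (hs.subset (by simp)) hx
  | re =>
    obtain ⟨k, h1, h2⟩ := hL
    exact ⟨k, h1, hsub _ h2⟩
  | wb =>
    obtain ⟨k, h1, h2⟩ := hL
    exact ⟨k, h1, hfresh k h2⟩
  | ww =>
    obtain ⟨k, h1, h2, h3⟩ := hL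
    exact ⟨k, h1, hfresh k h2, hdone _ _ h3⟩
  | wr =>
    obtain ⟨k, v, h1, h2, h3, h4⟩ := hL
    obtain ⟨h5, h6⟩ := hval rfl h4
    exact ⟨k, v, h1, hsub _ h2, h3.trans h6.symm, h5⟩
  | we =>
    obtain ⟨k, v, h1, h2⟩ := hL
    exact ⟨k, v, h1, hsub _ h2⟩

theorem LocalInv.snoc {h : List (RegAction Tid Id)} {A C : List (RegOp Tid Id)}
    {lock : Bool} {n : ℕ} {p : Tid} {vs : Set ℕ} {start arg : ℕ} {pc : PC}
    (hL : LocalInv h A C lock n p vs start arg pc) {a : RegAction Tid Id} (ha : a.tid ≠ p) :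
    LocalInv (h ++ [a]) A C lock n p vs start arg pc := by
  have hd : ∀ {m v k A'}, DoneIn h (.inv m v p k) (A ++ C) A' →
      DoneIn (h ++ [a]) (.inv m v p k) (A ++ C) A' := by
    intro m v k A' hd
    refine hd.snoc ?_
    rintro rfl
    exact ha rfl
  cases pc with
  | rl =>
    obtain ⟨k, h1, h2, h3, h4⟩ := hL
    refine ⟨k, (proj_snoc_ne h ha).symm ▸ h1, h2, fun hs => hd (h3 hs), fun v hv => ?_⟩
    obtain ⟨P, S, h5, h6, h7⟩ := h4 v hv
    exact ⟨P, S, h5, h6, hd h7⟩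
  | ww =>
    obtain ⟨k, h1, h2, h3⟩ := hL
    exact ⟨k, (proj_snoc_ne h ha).symm ▸ h1, h2, fun hs => hd (h3 hs)⟩
  | _ =>
    simp only [LocalInv, proj_snoc_ne h ha] at hL ⊢
    exact hL

/-- The invariant of `DR`, for the history `h` of an execution ending in `b` and the
linearization `A ++ C` of `h`. -/
structure Inv (h : List (RegAction Tid Id)) (b : State Tid Id) (A C : List (RegOp Tid Id)) :
    Prop where
  wf : WellFormed h
  lin : OpLin h (A ++ C)
  ids : ∀ p, b.ids p = usedIds h p
  loc : ∀ p, LocalInv h A C b.lock (b.ver + if b.lock then 1 else 0) p (b.vs p) (b.start p)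
    (b.arg p) (b.pc p)
  val : b.val = if b.lock then opVal A else opVal (A ++ C)
  cut : 0 < (b.ver + if b.lock then 1 else 0) → ∃ w B, C = w :: B ∧ w.IsWrite
  uniq : ∀ p q, b.pc p = .wr → b.pc q = .wr → p = q

open scoped Classical in
theorem uniq_update {pc : Tid → PC} (h : ∀ p q, pc p = .wr → pc q = .wr → p = q) (p : Tid) {c : PC}
    (hc : c ≠ .wr) : ∀ q r, Function.update pc p c q = .wr → Function.update pc p c r = .wr →
      q = r := by
  intro q r hq hr
  by_cases hqp : q = p
  · subst hqp
    exact absurd (by simpa using hq) hc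
  by_cases hrp : r = p
  · subst hrp
    exact absurd (by simpa using hr) hc
  · rw [Function.update_of_ne hqp] at hq
    rw [Function.update_of_ne hrp] at hr
    exact h q r hq hr

open scoped Classical in
theorem update_usedIds {h : List (RegAction Tid Id)} {ids : Tid → List Id}
    (hids : ∀ p, ids p = usedIds h p) {a : RegAction Tid Id} (ha : a.isInv) (p : Tid) :
    Function.update ids a.tid (ids a.tid ++ [a.id]) p = usedIds (h ++ [a]) p := by
  by_cases hp : p = a.tid
  · subst hp
    rw [Function.update_self, usedIds_snoc_inv h ha, hids]
  · rw [Function.update_of_ne hp, usedIds_snoc_ne h (Ne.symm hp), hids]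

theorem Inv.wellFormed_snoc_inv {h : List (RegAction Tid Id)} {b : State Tid Id}
    {A C : List (RegOp Tid Id)} (hI : Inv h b A C) {a : RegAction Tid Id} (ha : a.isInv)
    (hpc : b.pc a.tid = .main) (hk : a.id ∉ b.ids a.tid) : WellFormed (h ++ [a]) := by
  refine (wellFormed_snoc_inv_iff ha).2 ⟨hI.wf, ?_, hI.ids _ ▸ hk⟩
  have := hI.loc a.tid
  rw [hpc] at this
  exact this

/-- The read may land on either side of the distinguished cut between `A` and `C`. The cut is
adjusted so that it keeps its value and `C` keeps its first write. -/
theorem exists_read_insertion {A C P S : List (RegOp Tid Id)} (he : A ++ C = P ++ S)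
    (z : RegOp Tid Id) (hz : ¬ z.IsWrite) :
    ∃ A' C', A' ++ C' = P ++ z :: S ∧ opVal A' = opVal A ∧ (∀ x ∈ A, x ∈ A') ∧
      ∀ w B, C = w :: B → ∃ B', C' = w :: B' := by
  have hval : ∀ n l, valFrom n (z :: l) = valFrom n l := by
    cases z with
    | read => exact fun _ _ => rfl
    | write => exact absurd trivial hz
  rcases List.append_eq_append_iff.1 he with ⟨a, rfl, rfl⟩ | ⟨c, rfl, rfl⟩
  · cases a with
    | nil =>
      -- Exactly at the cut, the read goes to the left part, so that `C` still starts with the top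
      -- write.
      refine ⟨A ++ [z], S, by simp, ?_, by simp +contextual, fun w B h => ⟨B, h⟩⟩
      rw [opVal, valFrom_append, hval]
      rfl
    | cons w a => exact ⟨A, w :: a ++ z :: S, by simp, rfl, by simp, by simp +contextual⟩
  · refine ⟨P ++ z :: c, C, by simp, ?_, ?_, fun w B h => ⟨B, h⟩⟩
    · rw [opVal, valFrom_append, hval, ← valFrom_append]
    · intro x hx
      rcases List.mem_append.1 hx with hx | hx <;> simp [hx]

/-- The two alternatives of `hdone` are the insertions below the top, with `n` unchanged, and the
new top write, with the whole old list on its left. -/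
theorem LocalInv.insert {h : List (RegAction Tid Id)} {A C A' C' P S : List (RegOp Tid Id)}
    {z : RegOp Tid Id} (he : A ++ C = P ++ S) (he' : A' ++ C' = P ++ z :: S)
    (hins : Insertable P z S) {p : Tid} (hzp : z.tid ≠ p) (hzh : z.res ∉ h)
    {lock lock' : Bool} {n n' : ℕ} {vs : Set ℕ} {start arg : ℕ} {pc : PC}
    (hval : pc = .wr → lock = true → lock' = true ∧ opVal (A' ++ C') = opVal (A ++ C))
    (hdone : (n' = n ∧ ∀ x ∈ A, x ∈ A') ∨ A' = A ++ C)
    (hL : LocalInv h A C lock n p vs start arg pc) :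
    LocalInv h A' C' lock' n' p vs start arg pc := by
  have hmem : ∀ x, x ∈ A' ++ C' ↔ x = z ∨ x ∈ A ++ C := by
    intro x
    rw [he, he']
    simp only [List.mem_append, List.mem_cons]
    tauto
  refine hL.mono (fun x hx => ?_) (fun x hx => (hmem x).2 (.inr hx)) hval ?_ ?_
  · rcases (hmem x).1 hx with rfl | hx
    · exact .inr ⟨hzp, hzh⟩
    · exact .inl hx
  · intro i s hd hs x hx hxs
    rcases (hmem x).1 hx with rfl | hx'
    · exact absurd (hxs.subset (by simp)) hzh
    rcases hdone with ⟨rfl, hA⟩ | rfl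
    · exact hA x (hd hs x hx' hxs)
    · exact hx'
  · intro P₁ S₁ h₁
    rw [he']
    exact hins.exists_split (he ▸ h₁)

theorem append_filterMap_inr (h : List (RegAction Tid Id)) (p : Tid) :
    h ++ [(Sum.inr p : RegAction Tid Id ⊕ Tid)].filterMap Sum.getLeft? = h :=
  List.append_nil h

open scoped Classical in
theorem Inv.step {h : List (RegAction Tid Id)} {b b' : State Tid Id} {A C : List (RegOp Tid Id)}
    {σ : RegAction Tid Id ⊕ Tid} (hI : Inv h b A C) (hs : Step b σ b') :
    ∃ A' C', Inv (h ++ [σ].filterMap Sum.getLeft?) b' A' C' ∧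
      (A ++ C).Sublist (A' ++ C') := by
  cases hs with
  | readInv p k hpc hk =>
    have hw := hI.wellFormed_snoc_inv (a := .inv .read none p k) rfl hpc hk
    refine ⟨A, C, ⟨hw, hI.lin.snoc_inv rfl hw, update_usedIds hI.ids (a := Action.inv RegMethod.read none p k) rfl, fun q => ?_, hI.val, hI.cut,
      uniq_update hI.uniq p (by simp)⟩, List.Sublist.refl _⟩
    by_cases hq : q = p
    · subst hq
      simp only [Function.update_self]
      refine ⟨k, ?_, hI.lin.key_ne_of_notMem (hI.ids q ▸ hk)⟩
      have := proj_snoc_self h (.inv .read none q k)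
      exact (congrArg List.getLast? this).trans (by simp)
    · simp only [Function.update_of_ne hq]
      exact (hI.loc q).snoc (fun h => hq h.symm)
  | readInit p hpc hl =>
    rw [append_filterMap_inr]
    refine ⟨A, C, ⟨hI.wf, hI.lin, hI.ids, fun q => ?_,
      hI.val, hI.cut, uniq_update hI.uniq p (by simp)⟩, List.Sublist.refl _⟩
    have hloc := hI.loc q
    have hval := hI.val
    by_cases hq : q = p
    · subst hq
      rw [hpc] at hloc
      simp only [Function.update_self, hl, Bool.false_eq_true, if_false] at hloc hval ⊢
      obtain ⟨k, h1, h2⟩ := hloc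
      -- With the lock free, `start` equals `n`, so the claim about `A` is vacuous. The loaded value
      -- belongs to the end of the list, a cut that is always open.
      refine ⟨k, h1, h2, fun hlt => absurd hlt (by simp), ?_⟩
      rintro v rfl
      exact ⟨A ++ C, [], by simp, hval.symm, fun _ hx _ => hx⟩
    · simp only [Function.update_of_ne hq]
      exact hloc
  | readLoop p hpc hv hver =>
    rw [append_filterMap_inr]
    refine ⟨A, C, ⟨hI.wf, hI.lin, hI.ids, fun q => ?_,
      hI.val, hI.cut, hI.uniq⟩, List.Sublist.refl _⟩
    have hloc := hI.loc q
    have hval := hI.val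
    by_cases hq : q = p
    · subst hq
      rw [hpc] at hloc
      simp only [Function.update_self, hpc]
      obtain ⟨k, h1, h2, h3, h4⟩ := hloc
      refine ⟨k, h1, h2, h3, fun v hv' => ?_⟩
      rcases hv' with rfl | hv'
      · cases hl : b.lock with
        | false =>
          rw [hl] at hval
          exact ⟨A ++ C, [], by simp, hval.symm, fun _ hx _ => hx⟩
        | true =>
          rw [hl] at hval
          -- Under the lock `n` is `Ver + 1`, so the guard `start ≤ Ver` says `start < n` and opens
          -- the cut before the top write. The temporary value of the register is the value there.
          refine ⟨A, C, rfl, hval.symm, h3 ?_⟩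
          simpa [hl] using Nat.lt_succ_of_le hver
      · exact h4 v hv'
    · simp only [Function.update_of_ne hq]
      exact hloc
  | readPick p out hpc hout =>
    rw [append_filterMap_inr]
    have hloc := hI.loc p
    rw [hpc] at hloc
    obtain ⟨k, h1, h2, h3, h4⟩ := hloc
    -- The read is linearized at the cut recorded for the value that it picks.
    obtain ⟨P, S, he, hP, hd⟩ := h4 out hout
    have hins : Insertable P (.read p k out) S := .inl ⟨p, k, by rw [hP]⟩
    obtain ⟨A', C', he', hvA, hA, hC⟩ := exists_read_insertion he (.read p k out) id
    have hzh : (RegOp.read p k out).res ∉ h := hI.lin.res_notMem h2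
    have hsub : (P ++ S).Sublist (P ++ .read p k out :: S) :=
      (List.Sublist.refl P).append (List.sublist_cons_self _ _)
    have hvL : opVal (A' ++ C') = opVal (A ++ C) := by
      rw [he', he]
      exact hins.opVal_eq (a := S) (S₁ := []) (by simp) (.inr id)
    refine ⟨A', C', ⟨hI.wf, ?_, hI.ids, fun q => ?_, ?_, ?_,
      uniq_update hI.uniq p (by simp)⟩, by rw [he, he']; exact hsub⟩
    · rw [he']
      exact (he ▸ hI.lin).insert (he ▸ h2) h1 (he ▸ hd) hins
    · by_cases hq : q = p
      · subst hq
        simp only [Function.update_self]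
        exact ⟨k, h1, by simp [he']⟩
      · simp only [Function.update_of_ne hq]
        exact (hI.loc q).insert he he' hins (Ne.symm hq) hzh (fun _ hl => ⟨hl, hvL⟩) (.inl ⟨rfl, hA⟩)
    · have := hI.val
      dsimp only
      rw [this, hvA, hvL]
    · intro hn
      obtain ⟨w, B, hw, hw'⟩ := hI.cut hn
      obtain ⟨B', hB'⟩ := hC w B hw
      exact ⟨w, B', hB', hw'⟩
  | readRes p k hpc hk =>
    have hloc := hI.loc p
    rw [hpc] at hloc
    obtain ⟨k', h1, h2⟩ := hloc
    obtain rfl : k' = k := by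
      rw [hI.ids, usedIds_getLast? rfl h1] at hk
      exact Option.some.inj hk
    have hlin := hI.lin.snoc_res h2 h1
    have hwf : WellFormed (h ++ [(RegOp.read p k' (b.arg p)).res]) :=
      (wellFormed_snoc_res_iff rfl).2 ⟨hI.wf, _, h1, (RegOp.read p k' (b.arg p)).inv_matches_res⟩
    refine ⟨A, C, ⟨hwf, hlin, fun q => ?_, fun q => ?_, hI.val, hI.cut,
      uniq_update hI.uniq p (by simp)⟩, List.Sublist.refl _⟩
    · exact (hI.ids q).trans (usedIds_snoc_res h (by rfl) q).symm
    · by_cases hq : q = p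
      · subst hq
        simp only [Function.update_self]
        intro a ha
        have := proj_snoc_self h (.res .read (some (b.arg q)) q k')
        have ha := (congrArg List.getLast? this).symm.trans ha
        simp only [List.getLast?_append, List.getLast?_singleton, Option.some_or,
          Option.some.injEq] at ha
        exact ha ▸ rfl
      · simp only [Function.update_of_ne hq]
        exact (hI.loc q).snoc (fun h => hq h.symm)
  | writeInv p k v hpc hk =>
    have hw := hI.wellFormed_snoc_inv (a := .inv .write (some v) p k) rfl hpc hk
    refine ⟨A, C, ⟨hw, hI.lin.snoc_inv rfl hw, update_usedIds hI.ids (a := Action.inv RegMethod.write (some v) p k) rfl, fun q => ?_, hI.val, hI.cut,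
      uniq_update hI.uniq p (by simp)⟩, List.Sublist.refl _⟩
    by_cases hq : q = p
    · subst hq
      simp only [Function.update_self]
      refine ⟨k, ?_, hI.lin.key_ne_of_notMem (hI.ids q ▸ hk)⟩
      have := proj_snoc_self h (.inv .write (some v) q k)
      exact (congrArg List.getLast? this).trans (by simp)
    · simp only [Function.update_of_ne hq]
      exact (hI.loc q).snoc (fun h => hq h.symm)
  | writeInit p hpc hl =>
    rw [append_filterMap_inr]
    refine ⟨A, C, ⟨hI.wf, hI.lin, hI.ids, fun q => ?_,
      hI.val, hI.cut, uniq_update hI.uniq p (by simp)⟩, List.Sublist.refl _⟩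
    have hloc := hI.loc q
    by_cases hq : q = p
    · subst hq
      rw [hpc] at hloc
      simp only [Function.update_self, hl, Bool.false_eq_true, if_false] at hloc ⊢
      obtain ⟨k, h1, h2⟩ := hloc
      exact ⟨k, h1, h2, fun hlt => absurd hlt (by simp)⟩
    · simp only [Function.update_of_ne hq]
      exact hloc
  | writeTop p hpc hl =>
    rw [append_filterMap_inr]
    have hloc := hI.loc p
    rw [hpc] at hloc
    obtain ⟨k, h1, h2, h3⟩ := hloc
    set z : RegOp Tid Id := .write p k (b.arg p) with hzdef
    have hins : Insertable (A ++ C) z [] := .inr ⟨trivial, by simp⟩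
    have hzh : z.res ∉ h := hI.lin.res_notMem h2
    -- All previous operations are now left of the top write, so the condition for `start < n` holds
    -- for every other thread, whenever it started.
    refine ⟨A ++ C, [z], ⟨hI.wf, ?_, hI.ids, fun q => ?_, ?_, ?_,
      uniq_update hI.uniq p (by simp)⟩, List.sublist_append_left _ _⟩
    · refine OpLin.insert (by simpa using hI.lin)
        (fun x hx => h2 x (by simpa using hx)) h1 ?_ hins
      intro x hx _
      simpa using hx
    · by_cases hq : q = p
      · subst hq
        simp only [Function.update_self]
        exact ⟨k, _, h1, by simp [hzdef]⟩
      · simp only [Function.update_of_ne hq]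
        refine (hI.loc q).insert (P := A ++ C) (S := []) (by simp) (by simp) hins (Ne.symm hq) hzh
          (fun _ hl' => ?_) (.inr rfl)
        rw [hl] at hl'
        exact absurd hl' (by simp)
    · simp only [hl, Bool.false_eq_true, if_false]
      rw [opVal, valFrom_append]
      rfl
    · exact fun _ => ⟨z, [], rfl, trivial⟩
  | writeRollBack p hpc hver hl =>
    rw [append_filterMap_inr]
    have hloc := hI.loc p
    rw [hpc] at hloc
    simp only [hl, Bool.false_eq_true, if_false, Nat.add_zero] at hloc
    obtain ⟨k, h1, h2, h3⟩ := hloc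
    have hd := h3 hver
    -- The guard makes `Ver` positive, so a top write `w` exists and `z` goes directly before it.
    obtain ⟨w, B, rfl, hw⟩ := hI.cut (by omega)
    have hval := hI.val
    simp only [hl, Bool.false_eq_true, if_false] at hval
    set z : RegOp Tid Id := .write p k (b.arg p) with hzdef
    have hins : Insertable A z (w :: B) := .inr ⟨trivial, by simpa using hw⟩
    have hzh : z.res ∉ h := hI.lin.res_notMem h2
    have hvL : opVal (A ++ z :: w :: B) = opVal (A ++ w :: B) :=
      hins.opVal_eq (a := w :: B) (S₁ := []) (by simp) (.inl (by simp))
    have hwr : ∀ q, b.pc q ≠ .wr := by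
      intro q hq
      have := hI.loc q
      rw [hq, hl] at this
      obtain ⟨_, _, _, _, _, h5⟩ := this
      simp at h5
    refine ⟨A ++ [z], w :: B, ⟨hI.wf, ?_, hI.ids, fun q => ?_, ?_, ?_,
      ?_⟩, ?_⟩
    · rw [List.append_assoc]
      exact hI.lin.insert h2 h1 hd hins
    · by_cases hq : q = p
      · subst hq
        simp only [Function.update_self]
        refine ⟨k, _, h1, by simp [hzdef], ?_, rfl⟩
        -- The saved value is the final value of the old list; `z` does not change it because `w`
        -- overwrites `z`.
        rw [hval, List.append_assoc]
        exact hvL.symm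
      · simp only [Function.update_of_ne hq]
        refine (hI.loc q).insert rfl (by simp) hins (Ne.symm hq) hzh
          (fun hq' => absurd hq' (hwr q)) (.inl ⟨?_, by simp +contextual⟩)
        -- `Ver` is positive, so the truncated `Ver - 1`, plus one for the lock, is again `Ver`: the
        -- number `n` is unchanged.
        simp only [hl, if_true, Bool.false_eq_true, if_false]
        omega
    · simp only [if_true]
      rw [opVal, valFrom_append]
      rfl
    · exact fun _ => ⟨w, B, rfl, hw⟩
    · intro q r hq hr
      have : ∀ q, Function.update b.pc p .wr q = .wr → q = p := by
        intro q hq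
        by_contra hne
        rw [Function.update_of_ne hne] at hq
        exact hwr q hq
      exact (this q hq).trans (this r hr).symm
    · rw [List.append_assoc]
      exact (List.Sublist.refl A).append (List.sublist_cons_self _ _)
  | writeRollForward p hpc hl =>
    rw [append_filterMap_inr]
    have hloc := hI.loc p
    rw [hpc] at hloc
    obtain ⟨k, v, h1, h2, h3, h4⟩ := hloc
    have hcut := hI.cut
    simp only [hl, if_true] at hcut
    refine ⟨A, C, ⟨hI.wf, hI.lin, hI.ids, fun q => ?_,
      by simpa using h3, by simpa using hcut, uniq_update hI.uniq p (by simp)⟩, List.Sublist.refl _⟩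
    by_cases hq : q = p
    · subst hq
      simp only [Function.update_self]
      exact ⟨k, v, h1, h2⟩
    · simp only [Function.update_of_ne hq]
      have hloc := hI.loc q
      simp only [hl, if_true] at hloc
      -- Roll-forward leaves the list and `n` unchanged. The lock is released, but no other thread
      -- is at `wr`.
      refine hloc.mono (fun _ hx => .inl hx) (fun _ => id)
        (fun hq' => absurd (hI.uniq q p hq' hpc) hq) (fun _ _ => id) fun P S he => ⟨P, S, he, rfl, fun _ => id⟩
  | writeRes p k hpc hk =>
    have hloc := hI.loc p
    rw [hpc] at hloc
    obtain ⟨k', v, h1, h2⟩ := hloc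
    obtain rfl : k' = k := by
      rw [hI.ids, usedIds_getLast? rfl h1] at hk
      exact Option.some.inj hk
    have hlin := hI.lin.snoc_res h2 h1
    have hwf : WellFormed (h ++ [(RegOp.write p k' v).res]) :=
      (wellFormed_snoc_res_iff rfl).2 ⟨hI.wf, _, h1, (RegOp.write p k' v).inv_matches_res⟩
    refine ⟨A, C, ⟨hwf, hlin, fun q => ?_, fun q => ?_, hI.val, hI.cut,
      uniq_update hI.uniq p (by simp)⟩, List.Sublist.refl _⟩
    · exact (hI.ids q).trans (usedIds_snoc_res h (by rfl) q).symm
    · by_cases hq : q = p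
      · subst hq
        simp only [Function.update_self]
        intro a ha
        have := proj_snoc_self h (.res .write none q k')
        have ha := (congrArg List.getLast? this).symm.trans ha
        simp only [List.getLast?_append, List.getLast?_singleton, Option.some_or,
          Option.some.injEq] at ha
        exact ha ▸ rfl
      · simp only [Function.update_of_ne hq]
        exact (hI.loc q).snoc (fun h => hq h.symm)

theorem inv_init : Inv [] (dr Tid Id).init [] [] := by
  refine ⟨?_, ?_, fun p => rfl, fun p => ?_, rfl, fun h => absurd h (by simp [dr]), ?_⟩
  · exact fun p => ⟨.nil, by simp [proj]⟩
  · exact ⟨by simp, by simp [Legal], by simp, by simp, by simp, by simp⟩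
  · simp [LocalInv, proj, dr]
  · simp [dr]

theorem exists_inv_of_isPath {e : List (State Tid Id × (RegAction Tid Id ⊕ Tid) × State Tid Id)}
    (he : (dr Tid Id).IsPath (dr Tid Id).init e) :
    ∃ A C, Inv (histOf e) (LTS.endState (dr Tid Id).init e) A C := by
  induction e using List.reverseRecOn with
  | nil => exact ⟨[], [], inv_init⟩
  | append_singleton e t ih =>
    obtain ⟨h1, h2, h3⟩ := (LTS.isPath_snoc_iff _ _ _ _).1 he
    obtain ⟨A, C, hI⟩ := ih h1
    rw [← h2] at hI
    obtain ⟨A', C', hI', _⟩ := hI.step h3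
    exact ⟨A', C', by simpa using hI'⟩

theorem properInvocation_of_step {b b' : State Tid Id} {a : RegAction Tid Id}
    (hs : Step b (.inl a) b') : ProperInvocation a := by
  cases hs <;> simp [ProperInvocation]

theorem isRegisterImplementation : IsRegisterImplementation (dr Tid Id) := by
  refine ⟨fun e => ?_, fun e a ha => ?_⟩
  · obtain ⟨A, C, hI⟩ := exists_inv_of_isPath e.2
    exact hI.wf
  · obtain ⟨e, he⟩ := e
    change a ∈ histOf e at ha
    induction e using List.reverseRecOn with
    | nil => simp [histOf] at ha
    | append_singleton e t ih =>
      obtain ⟨h1, h2, h3⟩ := (LTS.isPath_snoc_iff _ _ _ _).1 he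
      rw [histOf_snoc] at ha
      rcases List.mem_append.1 ha with ha | ha
      · exact ih h1 ha
      · obtain ⟨q, σ, q'⟩ := t
        cases σ with
        | inl c =>
          obtain rfl : a = c := by simpa using ha
          exact properInvocation_of_step h3
        | inr c => simp at ha

/-- The invariant does not determine the list. One is chosen along each execution, and it only gains
operations, which is decisiveness. -/
theorem decisivelyLinearizable : DecisivelyLinearizable (dr Tid Id) (regSpec Tid Id) := by
  obtain ⟨F, hF, hmono⟩ := (dr Tid Id).exists_monotone_choice
    (α := List (RegOp Tid Id) × List (RegOp Tid Id))
    (fun a b => (a.1 ++ a.2).Sublist (b.1 ++ b.2)) (fun _ => List.Sublist.refl _)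
    (fun _ _ _ => List.Sublist.trans)
    (fun e a => Inv (histOf e) (LTS.endState (dr Tid Id).init e) a.1 a.2) ([], []) inv_init
    (by
      intro e t a he hI
      obtain ⟨h1, h2, h3⟩ := (LTS.isPath_snoc_iff _ _ _ _).1 he
      rw [← h2] at hI
      obtain ⟨A', C', hI', hs⟩ := hI.step h3
      exact ⟨(A', C'), by simpa using hI', hs⟩)
  refine ⟨fun e => flat ((F e).1 ++ (F e).2), fun e => ?_, fun e₁ e₂ h =>
    flat_sublist_of_sublist (hmono e₁ e₂ h)⟩
  have hlin := (hF e).lin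
  exact ⟨flat_mem_regSpec_iff.2 ⟨hlin.nodup, hlin.legal⟩, hlin.linearizedBy (hF e).wf⟩

end DR

theorem LTS.Steps.append {Q : Type u} {Lab : Type v} {A : LTS Q Lab} {q₁ q₂ q₃ : Q}
    {ρ₁ ρ₂ : List Lab} (h₁ : A.Steps q₁ ρ₁ q₂) (h₂ : A.Steps q₂ ρ₂ q₃) :
    A.Steps q₁ (ρ₁ ++ ρ₂) q₃ := by
  induction ρ₁ generalizing q₁ with
  | nil =>
    obtain rfl : q₁ = q₂ := h₁
    exact h₂
  | cons l ρ₁ ih =>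
    obtain ⟨q, h, h'⟩ := h₁
    exact ⟨q, h, ih h'⟩

/-! ### `DR` follows insertions into a linearization -/

namespace DR

variable {Tid : Type w} {Id : Type x}

/-- There are internal transitions of `DR` from `b` to `b'`. -/
def Silent (b b' : State Tid Id) : Prop :=
  ∃ ρ, (dr Tid Id).Steps b ρ b' ∧ ρ.filterMap Sum.getLeft? = []

theorem Silent.refl (b : State Tid Id) : Silent b b := ⟨[], rfl, rfl⟩

theorem Silent.trans {b₁ b₂ b₃ : State Tid Id} (h₁ : Silent b₁ b₂) (h₂ : Silent b₂ b₃) :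
    Silent b₁ b₃ := by
  obtain ⟨ρ₁, h₁, h₁'⟩ := h₁
  obtain ⟨ρ₂, h₂, h₂'⟩ := h₂
  exact ⟨ρ₁ ++ ρ₂, h₁.append h₂, by simp [h₁', h₂']⟩

theorem Silent.of_step {b b' : State Tid Id} {p : Tid} (h : Step b (.inr p) b') : Silent b b' :=
  ⟨[.inr p], ⟨b', h, rfl⟩, rfl⟩

/-- All active readers among the threads in `ps` can load the current value. -/
theorem exists_loops (ps : List Tid) (b : State Tid Id) :
    ∃ vs', Silent b { b with vs := vs' } ∧ (∀ p, b.vs p ⊆ vs' p) ∧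
      ∀ p ∈ ps, b.pc p = .rl → b.start p ≤ b.ver → b.val ∈ vs' p := by
  classical
  induction ps generalizing b with
  | nil => exact ⟨b.vs, Silent.refl b, fun _ => subset_rfl, by simp⟩
  | cons p ps ih =>
    by_cases hp : b.pc p = .rl ∧ b.start p ≤ b.ver ∧ b.val ∉ b.vs p
    · obtain ⟨vs', h1, h2, h3⟩ := ih
        { b with vs := Function.update b.vs p (insert b.val (b.vs p)) }
      have h4 : ∀ q, b.vs q ⊆ vs' q := by
        intro q
        refine subset_trans ?_ (h2 q)
        by_cases hq : q = p
        · subst hq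
          simp
        · simp [Function.update_of_ne hq]
      refine ⟨vs', (Silent.of_step (.readLoop b p hp.1 hp.2.2 hp.2.1)).trans h1, h4, ?_⟩
      intro q hq
      rcases List.mem_cons.1 hq with rfl | hq
      · intro _ _
        exact h2 q (by simp)
      · exact h3 q hq
    · obtain ⟨vs', h1, h2, h3⟩ := ih b
      refine ⟨vs', h1, h2, fun q hq hpc hs => ?_⟩
      rcases List.mem_cons.1 hq with rfl | hq
      · by_contra hv
        exact hp ⟨hpc, hs, fun hv' => hv (h2 q hv')⟩
      · exact h3 q hq hpc hs

/-- The state `b'` arises from `b` when the thread `p` executes a write of `n` that is visible to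
all readers in `ps` which started before the version `bound`. -/
structure Written (ps : List Tid) (p : Tid) (n bound : ℕ) (b b' : State Tid Id) : Prop where
  silent : Silent b b'
  lock : b'.lock = false
  ids : b'.ids = b.ids
  start : b'.start = b.start
  pc_self : b'.pc p = .we
  pc : ∀ q, q ≠ p → b'.pc q = b.pc q
  arg : ∀ q, q ≠ p → b'.arg q = b.arg q
  vs : ∀ q, b.vs q ⊆ b'.vs q
  seen : ∀ q ∈ ps, q ≠ p → b.pc q = .rl → b.start q < bound → n ∈ b'.vs q

/-- After the store the version is `b.ver + 1`, so every reader with `start ≤ b.ver + 1` can load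
the new value; hence the bound `b.ver + 2`. -/
theorem exists_written_top (ps : List Tid) {b : State Tid Id} {p : Tid} (hpc : b.pc p = .ww)
    (hl : b.lock = false) :
    ∃ b', Written ps p (b.arg p) (b.ver + 2) b b' ∧ b'.ver = b.ver + 1 ∧ b'.val = b.arg p := by
  classical
  have hstep := Step.writeTop b p hpc hl
  obtain ⟨vs', h1, h2, h3⟩ := exists_loops ps _
  refine ⟨_, ⟨(Silent.of_step hstep).trans h1, hl, rfl, rfl, ?_, ?_, fun _ _ => rfl, h2, ?_⟩,
    rfl, rfl⟩
  · simp
  · intro q hq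
    simp [Function.update_of_ne hq]
  · intro q hq hqp hpc' hs
    refine h3 q hq ?_ (Nat.le_of_lt_succ hs)
    simpa [Function.update_of_ne hqp] using hpc'

/-- The readers load `b.arg p` between roll-back and roll-forward. In that window the version is
`b.ver - 1`, which admits exactly those with `start < b.ver`. Value and version are then restored.
-/
theorem exists_written_rollBack (ps : List Tid) {b : State Tid Id} {p : Tid} (hpc : b.pc p = .ww)
    (hl : b.lock = false) (hver : b.start p < b.ver) :
    ∃ b', Written ps p (b.arg p) b.ver b b' ∧ b'.ver = b.ver ∧ b'.val = b.val := by
  classical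
  have hstep := Step.writeRollBack b p hpc hver hl
  obtain ⟨vs', h1, h2, h3⟩ := exists_loops ps _
  have hstep' := (Silent.of_step hstep).trans h1
  have hstep'' := hstep'.trans (Silent.of_step (Step.writeRollForward _ p (by simp) rfl))
  refine ⟨_, ⟨hstep'', rfl, rfl, rfl, ?_, ?_, ?_, h2, ?_⟩, ?_, ?_⟩
  · simp
  · intro q hq
    simp [Function.update_of_ne hq]
  · intro q hq
    simp [Function.update_of_ne hq]
  · intro q hq hqp hpc' hs
    refine h3 q hq ?_ (Nat.le_sub_one_of_lt hs)
    simpa [Function.update_of_ne hqp] using hpc'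
  · exact Nat.sub_add_cancel (by omega)
  · simp

/-- The thread `p` with the pending invocation `i` started its operation before the last write at
the top, or else no write in `K` can be after an insertion point for that operation. -/
def Late (h : List (RegAction Tid Id)) (K : List (RegOp Tid Id)) (i : RegAction Tid Id)
    (start ver : ℕ) : Prop :=
  start ≤ ver ∧ (start = ver → ∀ A B, K = A ++ B → DoneIn h i K A → ∀ w ∈ B, ¬ w.IsWrite)

/-- The relation of states of `DR` to histories `h` with linearization `K` that makes up the
simulation. -/
structure SimInv (h : List (RegAction Tid Id)) (K : List (RegOp Tid Id)) (b : State Tid Id) :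
    Prop where
  lock : b.lock = false
  ids : ∀ p, b.ids p = usedIds h p
  val : b.val = opVal K
  idle : ∀ p, (∀ a, (proj p h).getLast? = some a → a.isRes) → b.pc p = .main
  read : ∀ p k v, (proj p h).getLast? = some (.inv .read v p k) → b.pc p = .rl ∧
    Late h K (.inv .read v p k) (b.start p) b.ver ∧
    ∀ A B, K = A ++ B → DoneIn h (.inv .read v p k) K A → opVal A ∈ b.vs p
  write : ∀ p k n, (proj p h).getLast? = some (.inv .write (some n) p k) →
    (.write p k n ∈ K ∧ b.pc p = .we) ∨ (.write p k n ∉ K ∧ b.pc p = .ww ∧ b.arg p = n ∧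
      Late h K (.inv .write (some n) p k) (b.start p) b.ver)

theorem mem_insert_iff {P S : List (RegOp Tid Id)} {x z : RegOp Tid Id} :
    x ∈ P ++ z :: S ↔ x = z ∨ x ∈ P ++ S := by
  simp only [List.mem_append, List.mem_cons]
  tauto

/-- The splits of a list with an inserted element, compared to those of the original list. -/
theorem split_insert {h : List (RegAction Tid Id)} {P S A B : List (RegOp Tid Id)}
    {z : RegOp Tid Id} (hz : z ∉ P ++ S) (he : P ++ z :: S = A ++ B) {i : RegAction Tid Id}
    (hd : DoneIn h i (P ++ z :: S) A) :
    (∃ c, P = A ++ c ∧ B = c ++ z :: S ∧ DoneIn h i (P ++ S) A) ∨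
    ∃ a, A = P ++ z :: a ∧ S = a ++ B ∧ DoneIn h i (P ++ S) (P ++ a) := by
  have key : ∀ a, A = P ++ z :: a → DoneIn h i (P ++ S) (P ++ a) := by
    rintro a rfl x hx hs
    rcases mem_insert_iff.1 (hd x (mem_insert_iff.2 (.inr hx)) hs) with rfl | h
    · exact absurd hx hz
    · exact h
  have key' : DoneIn h i (P ++ S) A := fun x hx hs => hd x (mem_insert_iff.2 (.inr hx)) hs
  rcases List.append_eq_append_iff.1 he with ⟨a, rfl, h2⟩ | ⟨c, rfl, rfl⟩
  · cases a with
    | nil =>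
      left
      refine ⟨[], by simp, by simpa using h2.symm, ?_⟩
      simpa using key'
    | cons y a =>
      obtain ⟨rfl, rfl⟩ := List.cons_eq_cons.1 h2
      exact .inr ⟨a, rfl, rfl, key a rfl⟩
  · exact .inl ⟨c, rfl, rfl, key'⟩

/-- No transition of `DR` is needed: a read adds cuts but no values, and each new open cut comes
from an old open cut with the same value and the same writes on its right. -/
theorem SimInv.insert_read {h : List (RegAction Tid Id)} {P S : List (RegOp Tid Id)}
    {b : State Tid Id} (hI : SimInv h (P ++ S) b) {p : Tid} {k : Id} {n : ℕ}
    (hz : RegOp.read p k n ∉ P ++ S) : SimInv h (P ++ .read p k n :: S) b := by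
  have hval : ∀ a, opVal (P ++ .read p k n :: a) = opVal (P ++ a) := by
    intro a
    rw [opVal, opVal, valFrom_append, valFrom_append]
    rfl
  have hlate : ∀ {i s}, Late h (P ++ S) i s b.ver → Late h (P ++ .read p k n :: S) i s b.ver := by
    rintro i s ⟨h1, h2⟩
    refine ⟨h1, fun hs A B he hd w hw => ?_⟩
    rcases split_insert hz he hd with ⟨c, hP, rfl, hd'⟩ | ⟨a, rfl, hS, hd'⟩
    · rcases mem_insert_iff.1 hw with rfl | hw
      · exact id
      · exact h2 hs A (c ++ S) (by simp [hP]) hd' w hw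
    · exact h2 hs (P ++ a) B (by simp [hS]) hd' w hw
  refine ⟨hI.lock, hI.ids, hI.val.trans (hval S).symm, hI.idle, ?_, ?_⟩
  · intro q k' v hq
    obtain ⟨h1, h2, h3⟩ := hI.read q k' v hq
    refine ⟨h1, hlate h2, fun A B he hd => ?_⟩
    rcases split_insert hz he hd with ⟨c, hP, rfl, hd'⟩ | ⟨a, rfl, hS, hd'⟩
    · exact h3 A (c ++ S) (by simp [hP]) hd'
    · rw [hval]
      exact h3 (P ++ a) B (by simp [hS]) hd'
  · intro q k' m hq
    rcases hI.write q k' m hq with ⟨h1, h2⟩ | ⟨h1, h2, h3, h4⟩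
    · exact .inl ⟨mem_insert_iff.2 (.inr h1), h2⟩
    · refine .inr ⟨fun h => ?_, h2, h3, hlate h4⟩
      rcases mem_insert_iff.1 h with h | h
      · cases h
      · exact h1 h

/-- The part common to both ways of writing. `hlate` accounts for the change of version, and
`hbound` says that a reader is early enough to load `n` if a cut at which the value is `n` is open
to it. -/
theorem SimInv.insert_write_aux {h : List (RegAction Tid Id)} {P S : List (RegOp Tid Id)}
    {b b' : State Tid Id} (hI : SimInv h (P ++ S) b) {p : Tid} {k : Id} {n bound : ℕ}
    (hz : RegOp.write p k n ∉ P ++ S)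
    (hp : (proj p h).getLast? = some (.inv .write (some n) p k))
    (hW : Written (h.map Action.tid) p n bound b b')
    (hval : b'.val = opVal (P ++ .write p k n :: S))
    (hlate : ∀ i s, Late h (P ++ S) i s b.ver → Late h (P ++ .write p k n :: S) i s b'.ver)
    (hbound : ∀ i s a B, Late h (P ++ S) i s b.ver → S = a ++ B → DoneIn h i (P ++ S) (P ++ a) →
      (¬ ∃ w ∈ a, w.IsWrite) → s < bound) :
    SimInv h (P ++ .write p k n :: S) b' := by
  have hne : ∀ q m v k', (proj q h).getLast? = some (.inv m v q k') →
      (q = p → .inv m v q k' = (Action.inv .write (some n) p k : RegAction Tid Id)) := by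
    rintro q m v k' hq rfl
    rw [hp] at hq
    exact (Option.some.inj hq).symm
  refine ⟨hW.lock, fun q => ?_, hval, fun q hq => ?_, fun q k' v hq => ?_, fun q k' m hq => ?_⟩
  · rw [hW.ids, hI.ids]
  · have hqp : q ≠ p := by
      rintro rfl
      have := hq _ hp
      simp [Action.isRes] at this
    rw [hW.pc q hqp, hI.idle q hq]
  · have hqp : q ≠ p := by
      intro hqp
      have := hne _ _ _ _ hq hqp
      simp at this
    obtain ⟨h1, h2, h3⟩ := hI.read q k' v hq
    rw [hW.pc q hqp, hW.start]
    refine ⟨h1, hlate _ _ h2, fun A B he hd => ?_⟩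
    rcases split_insert hz he hd with ⟨c, hP, rfl, hd'⟩ | ⟨a, rfl, hS, hd'⟩
    · exact hW.vs q (h3 A (c ++ S) (by simp [hP]) hd')
    -- If another write lies between `z` and the cut, the value is that of an old open cut, already
    -- collected. Otherwise it is `n`, loaded while `DR` executed this write.
    · by_cases ha : ∃ w ∈ a, w.IsWrite
      · have := hW.vs q (h3 (P ++ a) B (by simp [hS]) hd')
        rw [opVal, valFrom_append] at this ⊢
        rwa [show valFrom (valFrom 0 P) (.write p k n :: a) = valFrom n a from rfl,
          valFrom_eq_of_exists ha n (valFrom 0 P)]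
      · rw [opVal, valFrom_append,
          show valFrom (valFrom 0 P) (.write p k n :: a) = valFrom n a from rfl,
          valFrom_of_not_exists ha]
        refine hW.seen q ?_ hqp h1 (hbound _ _ a B h2 hS hd' ha)
        exact List.mem_map.2 ⟨_, mem_of_getLast? hq, rfl⟩
  · by_cases hqp : q = p
    · have := hne _ _ _ _ hq hqp
      obtain ⟨rfl, rfl⟩ : m = n ∧ k' = k := by
        simp at this
        tauto
      subst hqp
      exact .inl ⟨by simp, hW.pc_self⟩
    · rw [hW.pc q hqp, hW.arg q hqp, hW.start]
      rcases hI.write q k' m hq with ⟨h1, h2⟩ | ⟨h1, h2, h3, h4⟩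
      · exact .inl ⟨mem_insert_iff.2 (.inr h1), h2⟩
      · refine .inr ⟨fun h => ?_, h2, h3, hlate _ _ h4⟩
        rcases mem_insert_iff.1 h with h | h
        · injection h with h
          exact hqp h
        · exact h1 h

theorem SimInv.insert_write {h : List (RegAction Tid Id)} {P S : List (RegOp Tid Id)}
    {b : State Tid Id} (hI : SimInv h (P ++ S) b) {p : Tid} {k : Id} {n : ℕ}
    (hz : RegOp.write p k n ∉ P ++ S)
    (hp : (proj p h).getLast? = some (.inv .write (some n) p k))
    (hd : DoneIn h (.inv .write (some n) p k) (P ++ S) P) :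
    ∃ b', Silent b b' ∧ SimInv h (P ++ .write p k n :: S) b' := by
  obtain ⟨_, hpc, harg, hlate⟩ := (hI.write p k n hp).resolve_left fun h => hz h.1
  have hval : opVal (P ++ .write p k n :: S) = valFrom n S := by
    rw [opVal, valFrom_append]
    rfl
  by_cases hS : ∃ w ∈ S, w.IsWrite
  -- The cut between `P` and `S` is open for `z` and has a write on its right, so `Late` excludes
  -- `start = ver`: roll-back is enabled.
  · have hver : b.start p < b.ver := by
      refine lt_of_le_of_ne hlate.1 fun he => ?_
      obtain ⟨w, hw, hw'⟩ := hS
      exact hlate.2 he P S rfl hd w hw hw'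
    obtain ⟨b', hW, hver', hval'⟩ := exists_written_rollBack (h.map Action.tid) hpc hI.lock hver
    rw [harg] at hW
    obtain ⟨w, hw, hw'⟩ := hS
    refine ⟨b', hW.silent, hI.insert_write_aux hz hp hW ?_ ?_ ?_⟩
    · rw [hval', hI.val, hval, opVal, valFrom_append]
      exact valFrom_eq_of_exists ⟨w, hw, hw'⟩ _ _
    · rintro i s ⟨h1, h2⟩
      rw [hver']
      refine ⟨h1, fun hs A B he hd => ?_⟩
      rcases split_insert hz he hd with ⟨c, hP, rfl, hd'⟩ | ⟨a, rfl, hS', hd'⟩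
      -- A cut left of `z` has the old write `w` on its right, so it was not open to an operation
      -- with `start = ver`.
      · exact absurd hw' (h2 hs A (c ++ S) (by simp [hP]) hd' w (by simp [hw]))
      · exact h2 hs (P ++ a) B (by simp [hS']) hd'
    · rintro i s a B ⟨h1, h2⟩ rfl hd' ha
      refine lt_of_le_of_ne h1 fun hs => ?_
      rcases List.mem_append.1 hw with hw | hw
      · exact ha ⟨w, hw, hw'⟩
      · exact h2 hs (P ++ a) B (by simp) hd' w hw hw'
  · obtain ⟨b', hW, hver', hval'⟩ := exists_written_top (h.map Action.tid) hpc hI.lock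
    rw [harg] at hW hval'
    refine ⟨b', hW.silent, hI.insert_write_aux hz hp hW ?_ ?_ ?_⟩
    · rw [hval', hval, valFrom_of_not_exists hS]
    · rintro i s ⟨h1, h2⟩
      rw [hver']
      -- The version has grown beyond every `start`, so the second clause of `Late` is vacuous.
      exact ⟨by omega, fun hs => by omega⟩
    · rintro i s a B ⟨h1, h2⟩ _ _ _
      omega

/-- The missing operations are inserted from left to right. `P` is the part already in final form,
and the next operation goes between `P` and the rest of the old list. -/
theorem SimInv.exists_of_sublist {h : List (RegAction Tid Id)} {P K K' : List (RegOp Tid Id)}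
    {b : State Tid Id} (hI : SimInv h (P ++ K) b) (hK : K.Sublist K') (hn : (P ++ K').Nodup)
    (hpend : ∀ x ∈ K', x ∈ K ∨ (proj x.tid h).getLast? = some x.inv)
    (hord : ∀ x ∈ P ++ K', ∀ y ∈ P ++ K', [x.res, y.inv].Sublist h → [x, y].Sublist (P ++ K')) :
    ∃ b', Silent b b' ∧ SimInv h (P ++ K') b' := by
  induction hK generalizing P b with
  | slnil => exact ⟨b, Silent.refl b, hI⟩
  | @cons K K' z hK ih =>
    have hzK' : z ∉ K' := (List.nodup_cons.1 (List.nodup_append.1 hn).2.1).1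
    have hzK : z ∉ K := fun hz => hzK' (hK.subset hz)
    have hzP : z ∉ P := fun hz => (List.nodup_append.1 hn).2.2 z hz z (by simp) rfl
    have hz : z ∉ P ++ K := by simp [hzP, hzK]
    have hp := (hpend z (by simp)).resolve_left hzK
    -- An operation that returned before `z` was invoked precedes `z` in the final list, where the
    -- part before `z` is exactly `P`.
    have hd : DoneIn h z.inv (P ++ K) P := by
      intro x hx hs
      refine mem_left_of_sublist_pair hn (hord x ?_ z (by simp) hs)
      rcases List.mem_append.1 hx with hx | hx
      · simp [hx]
      · simp [hK.subset hx]
    obtain ⟨b₁, hb₁, hI₁⟩ : ∃ b', Silent b b' ∧ SimInv h (P ++ z :: K) b' := by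
      cases z with
      | read p k n => exact ⟨b, Silent.refl b, hI.insert_read hz⟩
      | write p k n => exact hI.insert_write hz hp hd
    rw [List.append_cons] at hI₁ hn hord ⊢
    obtain ⟨b₂, hb₂, hI₂⟩ := ih hI₁ hn (fun x hx => hpend x (by simp [hx])) hord
    exact ⟨b₂, hb₁.trans hb₂, hI₂⟩
  | @cons_cons K K' z hK ih =>
    have hzK' : z ∉ K' := (List.nodup_cons.1 (List.nodup_append.1 hn).2.1).1
    rw [List.append_cons] at hI hn hord ⊢
    refine ih hI hn (fun x hx => ?_) hord
    rcases hpend x (by simp [hx]) with h1 | h1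
    · rcases List.mem_cons.1 h1 with rfl | h1
      · exact absurd hx hzK'
      · exact .inl h1
    · exact .inr h1

theorem DoneIn.of_snoc {h : List (RegAction Tid Id)} {i a : RegAction Tid Id}
    {l A : List (RegOp Tid Id)} (hd : DoneIn (h ++ [a]) i l A) : DoneIn h i l A :=
  fun x hx hs => hd x hx (hs.trans (List.sublist_append_left _ _))

theorem Late.snoc {h : List (RegAction Tid Id)} {K : List (RegOp Tid Id)} {i : RegAction Tid Id}
    {s n : ℕ} (hL : Late h K i s n) (a : RegAction Tid Id) : Late (h ++ [a]) K i s n :=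
  ⟨hL.1, fun hs A B he hd => hL.2 hs A B he (DoneIn.of_snoc hd)⟩

/-- An action of the thread `a.tid` does not matter for the other threads. -/
theorem SimInv.snoc {h : List (RegAction Tid Id)} {K : List (RegOp Tid Id)} {b b' : State Tid Id}
    (hI : SimInv h K b) (a : RegAction Tid Id) (hlock : b'.lock = b.lock) (hver : b'.ver = b.ver)
    (hval : b'.val = b.val) (hids : ∀ p, b'.ids p = usedIds (h ++ [a]) p)
    (hpc : ∀ q, q ≠ a.tid → b'.pc q = b.pc q) (hvs : ∀ q, q ≠ a.tid → b'.vs q = b.vs q)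
    (hstart : ∀ q, q ≠ a.tid → b'.start q = b.start q)
    (harg : ∀ q, q ≠ a.tid → b'.arg q = b.arg q)
    (hidle : a.isRes → b'.pc a.tid = .main)
    (hread : ∀ k v, a = .inv .read v a.tid k → b'.pc a.tid = .rl ∧
      Late (h ++ [a]) K a (b'.start a.tid) b'.ver ∧
      ∀ A B, K = A ++ B → DoneIn (h ++ [a]) a K A → opVal A ∈ b'.vs a.tid)
    (hwrite : ∀ k n, a = .inv .write (some n) a.tid k → .write a.tid k n ∉ K ∧
      b'.pc a.tid = .ww ∧ b'.arg a.tid = n ∧ Late (h ++ [a]) K a (b'.start a.tid) b'.ver) :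
    SimInv (h ++ [a]) K b' := by
  have hself : ∀ c, (proj a.tid (h ++ [a])).getLast? = some c → a = c := by
    intro c hc
    rw [proj_snoc_self] at hc
    simpa using hc
  refine ⟨hlock.trans hI.lock, hids, hval.trans hI.val, fun q hq => ?_, fun q k v hq => ?_,
    fun q k n hq => ?_⟩
  · by_cases hqa : q = a.tid
    · subst hqa
      refine hidle (hq a ?_)
      rw [proj_snoc_self]
      simp
    · rw [proj_snoc_ne h (Ne.symm hqa)] at hq
      rw [hpc q hqa, hI.idle q hq]
  · by_cases hqa : q = a.tid
    · subst hqa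
      have := hself _ hq
      rw [← this]
      exact hread k v this
    · rw [proj_snoc_ne h (Ne.symm hqa)] at hq
      rw [hpc q hqa, hvs q hqa, hstart q hqa, hver]
      obtain ⟨h1, h2, h3⟩ := hI.read q k v hq
      exact ⟨h1, h2.snoc a, fun A B he hd => h3 A B he (DoneIn.of_snoc hd)⟩
  · by_cases hqa : q = a.tid
    · subst hqa
      have := hself _ hq
      rw [← this]
      exact .inr (hwrite k n this)
    · rw [proj_snoc_ne h (Ne.symm hqa)] at hq
      rw [hpc q hqa, harg q hqa, hstart q hqa, hver]
      rcases hI.write q k n hq with h1 | ⟨h1, h2, h3, h4⟩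
      · exact .inl h1
      · exact .inr ⟨h1, h2, h3, h4.snoc a⟩

/-- If the last operation of `K` has returned, a new operation has to be after all of `K`. -/
theorem eq_nil_of_doneIn_snoc {h : List (RegAction Tid Id)} {K A B : List (RegOp Tid Id)}
    (hlast : ∀ z ∈ K.getLast?, z.res ∈ h) (hn : K.Nodup) {a : RegAction Tid Id} (he : K = A ++ B)
    (hd : DoneIn (h ++ [a]) a K A) : B = [] := by
  subst he
  cases B using List.reverseRecOn with
  | nil => rfl
  | append_singleton B z =>
    have hz := hlast z (by rw [← List.append_assoc]; simp)
    have := hd z (by simp) ((List.singleton_sublist.2 hz).append (List.Sublist.refl [a]))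
    exact absurd rfl ((List.nodup_append.1 hn).2.2 z this z (by simp))

/-- `DR` performs the init step right after the invocation. The only cut open to the new operation
is the end of `K`, so `start = ver` is harmless and the current value is the only one that a read
has to hold. -/
theorem SimInv.exists_inv {h : List (RegAction Tid Id)} {K : List (RegOp Tid Id)}
    {b : State Tid Id} (hI : SimInv h K b) {a : RegAction Tid Id} (ha : a.isInv)
    (hprop : ProperInvocation a) (hw : WellFormed (h ++ [a]))
    (hlast : ∀ z ∈ K.getLast?, z.res ∈ h) (hn : K.Nodup) (hK : ∀ x ∈ K, x.inv ∈ h) :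
    ∃ b' ρ, (dr Tid Id).Steps b ρ b' ∧ ρ.filterMap Sum.getLeft? = [a] ∧ SimInv (h ++ [a]) K b' := by
  classical
  obtain ⟨_, hidle, hid⟩ := (wellFormed_snoc_inv_iff ha).1 hw
  have hpc := hI.idle _ hidle
  have hids := update_usedIds hI.ids ha
  have hnil := fun A B => eq_nil_of_doneIn_snoc (A := A) (B := B) (a := a) hlast hn
  have hlate : Late (h ++ [a]) K a b.ver b.ver :=
    ⟨le_rfl, fun _ A B he hd w hw => by
      rw [hnil A B he hd] at hw
      simp at hw⟩
  have hid' := hid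
  rw [← hI.ids] at hid
  cases a with
  | res => simp [Action.isInv] at ha
  | inv m v p k =>
    cases m with
    | read =>
      obtain rfl : v = none := hprop
      refine ⟨_, [_, _], ⟨_, Step.readInv b p k hpc hid, _,
        Step.readInit _ p (Function.update_self p PC.rb b.pc) hI.lock, rfl⟩, rfl,
        hI.snoc _ rfl rfl rfl hids ?_ ?_ ?_ ?_ ?_ ?_ ?_⟩
      · intro q hq
        simp only [Function.update_of_ne (show q ≠ p from hq)]
      · intro q hq
        simp only [Function.update_of_ne (show q ≠ p from hq)]
      · intro q hq
        simp only [Function.update_of_ne (show q ≠ p from hq)]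
      · exact fun q hq => rfl
      · simp [Action.isRes]
      · intro k' v hk
        simp only [Action.tid, Function.update_self]
        refine ⟨trivial, hlate, fun A B he hd => ?_⟩
        have := hnil A B he hd
        subst this
        rw [List.append_nil] at he
        rw [← he]
        exact hI.val.symm
      · simp
    | write =>
      obtain ⟨n, rfl⟩ : ∃ n, v = some n := hprop
      refine ⟨_, [_, _], ⟨_, Step.writeInv b p k n hpc hid, _,
        Step.writeInit _ p (Function.update_self p PC.wb b.pc) hI.lock, rfl⟩, rfl,
        hI.snoc _ rfl rfl rfl hids ?_ ?_ ?_ ?_ ?_ ?_ ?_⟩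
      · intro q hq
        simp only [Function.update_of_ne (show q ≠ p from hq)]
      · exact fun q hq => rfl
      · intro q hq
        simp only [Function.update_of_ne (show q ≠ p from hq)]
      · intro q hq
        simp only [Function.update_of_ne (show q ≠ p from hq)]
      · simp [Action.isRes]
      · simp
      · intro k' n' hk
        obtain ⟨rfl, rfl⟩ : n = n' ∧ k = k' := by simpa [Action.tid] using hk
        simp only [Action.tid, Function.update_self]
        exact ⟨fun hm => hid' (mem_usedIds rfl (hK _ hm)), trivial, trivial, hlate⟩

/-- A write of `K` has already been executed and merely returns. A read is still in its loop and
picks its output only now. -/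
theorem SimInv.exists_res {h : List (RegAction Tid Id)} {K : List (RegOp Tid Id)}
    {b : State Tid Id} (hI : SimInv h K b) {z : RegOp Tid Id} (hz : z ∈ K)
    (hp : (proj z.tid h).getLast? = some z.inv) (hn : K.Nodup) (hl : Legal K)
    (hord : ∀ x ∈ K, ∀ y ∈ K, [x.res, y.inv].Sublist h → [x, y].Sublist K) :
    ∃ b' ρ, (dr Tid Id).Steps b ρ b' ∧ ρ.filterMap Sum.getLeft? = [z.res] ∧
      SimInv (h ++ [z.res]) K b' := by
  classical
  have hid := usedIds_getLast? z.inv_isInv hp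
  rw [← hI.ids] at hid
  have hids : ∀ p, b.ids p = usedIds (h ++ [z.res]) p := fun p => by
    rw [usedIds_snoc_res h z.res_isRes, hI.ids]
  cases z with
  | read p k n =>
    obtain ⟨hpc, _, hvs⟩ := hI.read p k none hp
    obtain ⟨A, B, rfl⟩ := List.append_of_mem hz
    have hmem : n ∈ b.vs p := by
      -- By legality the output is the value at the cut just before the read, and the real-time
      -- order makes that cut open.
      rw [hl A p k n B rfl]
      refine hvs A _ rfl fun x hx hs => ?_
      exact mem_left_of_sublist_pair hn (hord x hx _ hz hs)
    have h2 := Step.readRes { b with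
      pc := Function.update b.pc p .re
      arg := Function.update b.arg p n } p k (Function.update_self p PC.re b.pc) hid
    simp only [Function.update_self] at h2
    refine ⟨_, [_, _], ⟨_, Step.readPick b p n hpc hmem, _, h2, rfl⟩, rfl,
      hI.snoc _ rfl rfl rfl hids ?_ ?_ ?_ ?_ ?_ ?_ ?_⟩
    · intro q hq
      simp only [Function.update_of_ne (show q ≠ p from hq)]
    · intro q hq
      simp only [Function.update_of_ne (show q ≠ p from hq)]
    · intro q hq
      simp only [Function.update_of_ne (show q ≠ p from hq)]
    · intro q hq
      simp only [Function.update_of_ne (show q ≠ p from hq)]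
    · intro _
      exact Function.update_self p _ _
    · simp [RegOp.res]
    · simp [RegOp.res]
  | write p k n =>
    have hpc : b.pc p = .we := by
      rcases hI.write p k n hp with h1 | h1
      · exact h1.2
      · exact absurd hz h1.1
    refine ⟨_, [_], ⟨_, Step.writeRes b p k hpc hid, rfl⟩, rfl,
      hI.snoc _ rfl rfl rfl hids ?_ ?_ ?_ ?_ ?_ ?_ ?_⟩
    · intro q hq
      simp only [Function.update_of_ne (show q ≠ p from hq)]
    · intro q hq
      simp only [Function.update_of_ne (show q ≠ p from hq)]
    · intro q hq
      simp only [Function.update_of_ne (show q ≠ p from hq)]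
    · intro q hq
      simp only [Function.update_of_ne (show q ≠ p from hq)]
    · intro _
      exact Function.update_self p _ _
    · simp [RegOp.res]
    · simp [RegOp.res]

end DR

/-! ### The linearization up to the last returned operation -/

section Lagged

variable {Tid : Type w} {Id : Type x}

open scoped Classical in
/-- The part of a linearization of `h` up to the last operation that has returned. -/
noncomputable def lagged (h : List (RegAction Tid Id)) (l : List (RegOp Tid Id)) :
    List (RegOp Tid Id) :=
  l.rdropWhile fun x => x.res ∉ h

theorem exists_lagged_append (h : List (RegAction Tid Id)) (l : List (RegOp Tid Id)) :
    ∃ D, l = lagged h l ++ D ∧ ∀ x ∈ D, x.res ∉ h := by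
  induction l using List.reverseRecOn with
  | nil => exact ⟨[], by simp [lagged], by simp⟩
  | append_singleton l x ih =>
    by_cases hx : x.res ∈ h
    · refine ⟨[], ?_, by simp⟩
      rw [lagged, List.rdropWhile_concat_neg _ _ _ (by simpa using hx), List.append_nil]
    · obtain ⟨D, h1, h2⟩ := ih
      refine ⟨D ++ [x], ?_, ?_⟩
      · rw [lagged, List.rdropWhile_concat_pos _ _ _ (by simpa using hx), ← List.append_assoc]
        exact congrArg (· ++ [x]) h1
      · intro y hy
        rcases List.mem_append.1 hy with hy | hy
        · exact h2 y hy
        · obtain rfl := List.mem_singleton.1 hy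
          exact hx

theorem res_mem_of_getLast?_lagged {h : List (RegAction Tid Id)} {l : List (RegOp Tid Id)} :
    ∀ z ∈ (lagged h l).getLast?, z.res ∈ h := by
  intro z hz
  have hz : (lagged h l).getLast? = some z := hz
  have hne : lagged h l ≠ [] := by
    intro he
    simp [he] at hz
  have := List.rdropWhile_last_not _ _ hne
  rw [List.getLast?_eq_some_getLast hne] at hz
  rw [← Option.some.inj hz]
  simpa [lagged] using this

theorem lagged_sublist_self (h : List (RegAction Tid Id)) (l : List (RegOp Tid Id)) :
    (lagged h l).Sublist l :=
  (List.rdropWhile_prefix _ l).sublist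

theorem mem_lagged {h : List (RegAction Tid Id)} {l : List (RegOp Tid Id)} {x : RegOp Tid Id}
    (hx : x ∈ l) (hr : x.res ∈ h) : x ∈ lagged h l := by
  obtain ⟨D, h1, h2⟩ := exists_lagged_append h l
  rw [h1] at hx
  exact (List.mem_append.1 hx).resolve_right fun hx => h2 x hx hr

/-- The last operation of `lagged h l` has returned in `h`, hence in `h'`. It therefore cannot be
sent into the discarded tail of `l'`, and neither can anything before it. -/
theorem lagged_sublist_lagged {h h' : List (RegAction Tid Id)} {l l' : List (RegOp Tid Id)}
    (hh : h ⊆ h') (hl : l.Sublist l') : (lagged h l).Sublist (lagged h' l') := by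
  obtain ⟨D, h1, h2⟩ := exists_lagged_append h' l'
  have h3 := (lagged_sublist_self h l).trans hl
  rw [h1] at h3
  obtain ⟨l₁, l₂, he, h4, h5⟩ := List.sublist_append_iff.1 h3
  cases l₂ using List.reverseRecOn with
  | nil => rwa [he, List.append_nil]
  | append_singleton l₂ z =>
    have hz := res_mem_of_getLast?_lagged (h := h) (l := l) z
      (by rw [he, ← List.append_assoc]; simp)
    exact absurd (hh hz) (h2 z (h5.subset (by simp)))

theorem Legal.of_append {l D : List (RegOp Tid Id)} (hl : Legal (l ++ D)) : Legal l := by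
  rintro A p k n B rfl
  exact hl A p k n (B ++ D) (by simp)

theorem OpLin.order_lagged {h : List (RegAction Tid Id)} {l : List (RegOp Tid Id)}
    (hl : OpLin h l) : ∀ x ∈ lagged h l, ∀ y ∈ lagged h l, [x.res, y.inv].Sublist h →
      [x, y].Sublist (lagged h l) := by
  intro x hx y hy hs
  have h1 := hl.order x ((lagged_sublist_self h l).subset hx) y
    ((lagged_sublist_self h l).subset hy) hs
  obtain ⟨A, B, he⟩ := List.append_of_mem hy
  obtain ⟨D, h2, _⟩ := exists_lagged_append h l
  have hn := hl.nodup.of_map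
  rw [h2, he, List.append_assoc, List.cons_append] at h1 hn
  have hxA := mem_left_of_sublist_pair hn h1
  rw [he]
  exact (List.singleton_sublist.2 hxA).append (List.singleton_sublist.2 (by simp) :
    [y].Sublist (y :: B))

theorem OpLin.nodup_lagged {h : List (RegAction Tid Id)} {l : List (RegOp Tid Id)}
    (hl : OpLin h l) : (lagged h l).Nodup :=
  hl.nodup.of_map.sublist (lagged_sublist_self h l)

theorem OpLin.legal_lagged {h : List (RegAction Tid Id)} {l : List (RegOp Tid Id)}
    (hl : OpLin h l) : Legal (lagged h l) := by
  obtain ⟨D, h1, _⟩ := exists_lagged_append h l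
  exact Legal.of_append (D := D) (h1 ▸ hl.legal)

/-- An operation that has returned in `h` is in any sequence of operations with distinct keys that
extends the lagged linearization of `h`. -/
theorem OpLin.mem_lagged_of_sublist {h : List (RegAction Tid Id)} {l l' : List (RegOp Tid Id)}
    (hl : OpLin h l) (hs : l.Sublist l') (hn : (l'.map key).Nodup) {x : RegOp Tid Id} (hx : x ∈ l')
    (hr : x.res ∈ h) : x ∈ lagged h l := by
  obtain ⟨y, hy, he⟩ := hl.res _ hr x.res_isRes
  have hk : y.key = x.key := by simpa using congrArg Action.key he
  obtain rfl := eq_of_key_eq hn (hs.subset hy) hx hk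
  exact mem_lagged hy hr

end Lagged

/-! ### The forward simulation -/

namespace DR

variable {Tid : Type w} {Id : Type x}

theorem Silent.steps_append {b b₁ b₂ : State Tid Id} (h : Silent b b₁)
    {ρ : List (RegAction Tid Id ⊕ Tid)} (hρ : (dr Tid Id).Steps b₁ ρ b₂) :
    ∃ ρ', (dr Tid Id).Steps b ρ' b₂ ∧ ρ'.filterMap Sum.getLeft? = ρ.filterMap Sum.getLeft? := by
  obtain ⟨ρ₀, h1, h2⟩ := h
  exact ⟨ρ₀ ++ ρ, h1.append hρ, by simp [h2]⟩

theorem Silent.append_steps {b b₁ b₂ : State Tid Id} {ρ : List (RegAction Tid Id ⊕ Tid)}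
    (hρ : (dr Tid Id).Steps b ρ b₁) (h : Silent b₁ b₂) :
    ∃ ρ', (dr Tid Id).Steps b ρ' b₂ ∧ ρ'.filterMap Sum.getLeft? = ρ.filterMap Sum.getLeft? := by
  obtain ⟨ρ₀, h1, h2⟩ := h
  exact ⟨ρ ++ ρ₀, hρ.append h1, by simp [h2]⟩

/-- `DR` follows a change of the linearization without response in the history. -/
theorem SimInv.exists_silent {h h' : List (RegAction Tid Id)} {l l' : List (RegOp Tid Id)}
    {b : State Tid Id} (hI : SimInv h' (lagged h l) b) (hl : OpLin h l) (hl' : OpLin h' l')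
    (hh : h ⊆ h') (hres : ∀ r ∈ h', r.isRes → r ∈ h) (hs : l.Sublist l') :
    ∃ b', Silent b b' ∧ SimInv h' (lagged h' l') b' := by
  refine hI.exists_of_sublist (P := []) (lagged_sublist_lagged hh hs) hl'.nodup_lagged ?_
    hl'.order_lagged
  intro x hx
  have hx' := (lagged_sublist_self h' l').subset hx
  refine (hl'.status x hx').imp_left fun hr => ?_
  exact hl.mem_lagged_of_sublist hs hl'.nodup hx' (hres _ hr x.res_isRes)

/-- The invocation is executed first, on the unchanged list, whose last operation has returned. The
insertions follow silently. -/
theorem SimInv.step_inv {h : List (RegAction Tid Id)} {l l' : List (RegOp Tid Id)}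
    {b : State Tid Id} {a : RegAction Tid Id} (hI : SimInv h (lagged h l) b) (hl : OpLin h l)
    (hl' : OpLin (h ++ [a]) l') (hw : WellFormed (h ++ [a])) (ha : a.isInv)
    (hprop : ProperInvocation a) (hs : l.Sublist l') :
    ∃ b' ρ, (dr Tid Id).Steps b ρ b' ∧ ρ.filterMap Sum.getLeft? = [a] ∧
      SimInv (h ++ [a]) (lagged (h ++ [a]) l') b' := by
  obtain ⟨b₁, ρ, h1, h2, h3⟩ := hI.exists_inv ha hprop hw res_mem_of_getLast?_lagged
    hl.nodup_lagged fun x hx => hl.inv_mem x ((lagged_sublist_self h l).subset hx)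
  obtain ⟨b₂, h4, h5⟩ := h3.exists_silent hl hl' (List.subset_append_left _ _) (by
    intro r hr hr'
    rcases List.mem_append.1 hr with hr | hr
    · exact hr
    · rw [List.mem_singleton.1 hr, Action.isRes_eq_not_isInv, ha] at hr'
      simp at hr') hs
  obtain ⟨ρ', h6, h7⟩ := Silent.append_steps h1 h4
  exact ⟨b₂, ρ', h6, h7.trans h2, h5⟩

/-- The insertions are executed before the response, relative to the history `h`: the responding
operation must be in the list before `DR` can return from it. -/
theorem SimInv.step_res {h : List (RegAction Tid Id)} {l l' : List (RegOp Tid Id)}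
    {b : State Tid Id} {a : RegAction Tid Id} (hI : SimInv h (lagged h l) b) (hl : OpLin h l)
    (hl' : OpLin (h ++ [a]) l') (hw : WellFormed (h ++ [a])) (ha : a.isRes)
    (hs : l.Sublist l') :
    ∃ b' ρ, (dr Tid Id).Steps b ρ b' ∧ ρ.filterMap Sum.getLeft? = [a] ∧
      SimInv (h ++ [a]) (lagged (h ++ [a]) l') b' := by
  obtain ⟨hwh, i, hi, hm⟩ := (wellFormed_snoc_res_iff ha).1 hw
  have hinv : ∀ x ∈ l', x.inv ∈ h := by
    intro x hx
    rcases List.mem_append.1 (hl'.inv_mem x hx) with h1 | h1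
    · exact h1
    · rw [← List.mem_singleton.1 h1] at ha
      simp at ha
  have hpend : ∀ x ∈ l', x.res = a → (proj x.tid h).getLast? = some x.inv := by
    rintro x hx rfl
    rw [res_tid] at hi
    rw [hi, hwh.inv_unique hm.1 x.inv_isInv (mem_of_getLast? hi) (hinv x hx)]
    simpa using hm.key_eq
  have hord : ∀ x ∈ lagged (h ++ [a]) l', ∀ y ∈ lagged (h ++ [a]) l', [x.res, y.inv].Sublist h →
      [x, y].Sublist (lagged (h ++ [a]) l') := fun x hx y hy hxy =>
    hl'.order_lagged x hx y hy (hxy.trans (List.sublist_append_left _ _))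
  obtain ⟨b₁, h1, h2⟩ := hI.exists_of_sublist (P := [])
    (lagged_sublist_lagged (List.subset_append_left h [a]) hs) hl'.nodup_lagged (by
      intro x hx
      have hx' := (lagged_sublist_self _ _).subset hx
      -- An operation that returned in `h` is in the list already. Any other is the one responding
      -- now, or is pending after the response; both are pending in `h`.
      rcases hl'.status x hx' with hr | hr
      · rcases List.mem_append.1 hr with hr | hr
        · exact .inl (hl.mem_lagged_of_sublist hs hl'.nodup hx' hr)
        · exact .inr (hpend x hx' (List.mem_singleton.1 hr))
      · right
        by_cases hxa : a.tid = x.tid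
        · rw [← hxa, proj_snoc_self, List.getLast?_append] at hr
          have : a = x.inv := by simpa using hr
          rw [this] at ha
          simp at ha
        · rwa [proj_snoc_ne h hxa] at hr) hord
  obtain ⟨z, hz, rfl⟩ := hl'.res a (by simp) ha
  obtain ⟨b₂, ρ, h3, h4, h5⟩ := h2.exists_res (mem_lagged hz (by simp)) (hpend z hz rfl)
    hl'.nodup_lagged hl'.legal_lagged hord
  obtain ⟨ρ', h6, h7⟩ := h1.steps_append h3
  exact ⟨b₂, ρ', h6, h7.trans h4, h5⟩

theorem simInv_init : SimInv [] [] (dr Tid Id).init := by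
  refine ⟨rfl, fun _ => rfl, rfl, fun _ _ => rfl, ?_, ?_⟩ <;> simp [proj]

theorem simulates_of_decisiveRegister {Q : Type y} {ι : Type z} {I : LTS Q (RegAction Tid Id ⊕ ι)}
    (hI : DecisiveRegister I) : Simulates I (dr Tid Id) := by
  obtain ⟨⟨hwf, hprop⟩, L, hL, hdec⟩ := hI
  choose f hf hlin using fun e => exists_opLin (hwf e) (hL e).1 (hL e).2
  have hmono : ∀ e₁ e₂ : I.Exec, e₁.1.IsPrefix e₂.1 → (f e₁).Sublist (f e₂) := by
    intro e₁ e₂ he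
    have := hdec e₁ e₂ he
    rw [hf, hf] at this
    exact sublist_of_flat_sublist (hlin e₂).nodup this
  -- The linearization belongs to an execution, not to a state, so the relation quantifies over the
  -- executions that reach `q`.
  refine ⟨fun q b => ∃ e : I.Exec, LTS.endState I.init e.1 = q ∧
    SimInv (hist e) (lagged (hist e) (f e)) b, ⟨⟨[], trivial⟩, rfl, ?_⟩, ?_⟩
  -- The empty history contains no invocation, so its linearization is empty.
  · have : f ⟨[], trivial⟩ = [] := List.eq_nil_iff_forall_not_mem.2 fun x hx => by
      have := (hlin _).inv_mem x hx
      simp [hist, LTS.Exec.trace] at this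
    rw [this]
    exact simInv_init
  · rintro q σ q' b hstep ⟨e, rfl, hb⟩
    let e' : I.Exec := ⟨e.1 ++ [(_, σ, q')], (I.isPath_snoc_iff _ _ _).2 ⟨e.2, rfl, hstep⟩⟩
    have hh : hist e' = hist e ++ [σ].filterMap Sum.getLeft? := histOf_snoc e.1 _
    have hs := hmono e e' (List.prefix_append _ _)
    have hw := hwf e'
    have hl' := hlin e'
    suffices ∃ b' ρ, (dr Tid Id).Steps b ρ b' ∧
        ρ.filterMap Sum.getLeft? = [σ].filterMap Sum.getLeft? ∧
        SimInv (hist e') (lagged (hist e') (f e')) b' by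
      obtain ⟨b', ρ, h1, h2, h3⟩ := this
      exact ⟨b', ρ, h1, h2, e', LTS.endState_snoc _ _ _, h3⟩
    cases σ with
    | inl a =>
      have hh : hist e' = hist e ++ [a] := hh
      have hp := hprop e' a (by simp [hh])
      rw [hh] at hw hl' ⊢
      by_cases ha : a.isInv
      · exact hb.step_inv (hlin e) hl' hw ha hp hs
      · exact hb.step_res (hlin e) hl' hw (by simpa [Action.isRes_eq_not_isInv] using ha) hs
    | inr c =>
      have hh : hist e' = hist e := hh.trans (List.append_nil _)
      rw [hh] at hl' ⊢
      obtain ⟨b', ⟨ρ, h1, h2⟩, h3⟩ := hb.exists_silent (hlin e) hl' (List.Subset.refl _)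
        (fun _ hr _ => hr) hs
      exact ⟨b', ρ, h1, h2, h3⟩

end DR

end RegSim

universe u v w x

theorem mainTheorem1 (Tid : Type u) (Id : Type v) :
    RegSim.DecisiveRegister (RegSim.dr Tid Id) ∧
    ∀ (Q : Type w) (ι : Type x) (I : RegSim.LTS Q (RegSim.RegAction Tid Id ⊕ ι)),
      RegSim.DecisiveRegister I → RegSim.Simulates I (RegSim.dr Tid Id) :=
  ⟨⟨RegSim.DR.isRegisterImplementation, RegSim.DR.decisivelyLinearizable⟩,
    fun _ _ _ hI => RegSim.DR.simulates_of_decisiveRegister hI⟩
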